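/- Theorem (regret of policy optimization with aggregate bandit feedback and known dynamics). **Setting.** Let $\mathcal S$ and $\mathcal A$ be finite sets with $S=|\mathcal S|\ge 1$ and $A=|\mathcal A|\ge 1$, let $H,K\ge 1$ be integers, let $s_{init}\in\mathcal S$, and for $h\in[H]=\{1,\dots,H\}$ let $p_h(\cdot\mid s,a)$ be a probability distribution on $\mathcal S$ for all $(s,a)\in\mathcal S\times\mathcal A$ (known to the learner). Let $\ell^1,\dots,\ell^K$ be cost functions, $\ell^k_h(s,a)\in[0,1]$, fixed in advance by an oblivious adversary and unknown to the learner. A policy $\pi$ consists of probability distributions $\pi_h(\cdot\mid s)$ on $\mathcal A$. Under $\pi$ an episode is $s_1=s_{init}$, $a_h\sim\pi_h(\cdot\mid s_h)$, $s_{h+1}\sim p_h(\cdot\mid s_h,a_h)$; write $V_1^\pi(s_{init};\ell)=\mathbb E\big[\sum_{h=1}^H \ell_h(s_h,a_h)\mid\pi\big]$, $\mu_h^\pi(s,a)=\Pr[s_h=s,a_h=a\mid\pi]$ and $\mu^\pi_h(s)=\sum_a\mu^\pi_h(s,a)$. **Algorithm.** Parameters $\eta,\gamma>0$. Start with $\pi^1_h(a\mid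 s)=1/A$. In episode $k=1,\dots,K$, play $\pi^k$, and observe the trajectory $(s^k_h,a^k_h)_{h=1}^H$ and only the aggregate loss $L^k=\sum_{h=1}^H\ell^k_h(s^k_h,a^k_h)$. With $\mu^k=\mu^{\pi^k}$, set $$\hat U^k_h(s,a)=\frac{\mathbb I\{s^k_h=s,a^k_h=a\}}{\mu^k_h(s,a)+\gamma}L^k,\qquad b^k_h(s)=\sum_{a}\frac{3\gamma H\,\pi^k_h(a\mid s)}{\mu^k_h(s)\pi^k_h(a\mid s)+\gamma},$$ $$B^k_{H+1}=0,\qquad B^k_h(s,a)=b^k_h(s)+\sum_{s',a'}p_h(s'\mid s,a)\,\pi^k_{h+1}(a'\mid s')\,B^k_{h+1}(s',a')\quad(h=H,\dots,1),$$ where the sum is $0$ for $h=H$, and update $$\pi^{k+1}_h(a\mid s)=\frac{\pi^k_h(a\mid s)\,e^{-\eta(\hat U^k_h(s,a)-B^k_h(s,a))}}{\sum_{a'}\pi^k_h(a'\mid s)\,e^{-\eta(\hat U^k_h(s,a')-B^k_h(s,a'))}}.$$ **Claim.** There is a universal constant $C>0$ such that for every such $\mathcal S,\mathcal A,H,K,s_{init},p,\ell^1,\dots,\ell^K$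 and every $\delta\in(0,1)$, running the algorithm with $$\eta=\big(H\sqrt{SAK}+H^2\sqrt K\big)^{-1},\qquad \gamma=2\eta H,$$ the regret $R_K=\sum_{k=1}^K V_1^{\pi^k}(s_{init};\ell^k)-\min_{\pi}\sum_{k=1}^K V_1^{\pi}(s_{init};\ell^k)$ (minimum over all policies) satisfies, with probability at least $1-\delta$, $$R_K\le C\,\log\!\Big(\frac{HSAK}{\delta}\Big)\big(H^2\sqrt{SAK}+H^3\sqrt K\big).$$ -/

import Mathlib

open scoped BigOperators ENNReal

noncomputable section

namespace AggregateBandit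

/-- Sampling one coordinate after the other, each from a distribution that may depend on the
earlier coordinates, gives total mass one. -/
theorem sum_prod_sequential {X : Type*} [Fintype X] :
    ∀ (n : ℕ) (q : (i : Fin n) → (Fin i → X) → X → ℝ), (∀ i past, ∑ x, q i past x = 1) →
      ∑ τ : Fin n → X, ∏ i : Fin n, q i (fun j => τ (Fin.castLE i.isLt.le j)) (τ i) = 1
  | 0, _, _ => by simp
  | n + 1, q, hq => by
    have ih := sum_prod_sequential n (fun i => q i.castSucc) (fun i past => hq i.castSucc past)
    rw [← (Fin.snocEquiv (fun _ : Fin (n + 1) => X)).sum_comp, Fintype.sum_prod_type_right]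
    simp only [Fin.prod_univ_castSucc]
    rw [← ih]
    refine Finset.sum_congr rfl fun τ _ => ?_
    have h1 : ∀ x : X, ∀ i : Fin n,
        (Fin.snocEquiv (fun _ : Fin (n + 1) => X)) (x, τ) i.castSucc = τ i := by
      intro x i; simp [Fin.snocEquiv]
    have h2 : ∀ x : X,
        (Fin.snocEquiv (fun _ : Fin (n + 1) => X)) (x, τ) (Fin.last n) = x := by
      intro x; simp [Fin.snocEquiv]
    have h3 : ∀ x : X, ∀ i : Fin n, (fun j : Fin i =>
        (Fin.snocEquiv (fun _ : Fin (n + 1) => X)) (x, τ)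
          (Fin.castLE (i.castSucc).isLt.le j)) = fun j => τ (Fin.castLE i.isLt.le j) := by
      intro x i; funext j; exact h1 x (Fin.castLE i.isLt.le j)
    have h4 : ∀ x : X, (fun j : Fin n =>
        (Fin.snocEquiv (fun _ : Fin (n + 1) => X)) (x, τ)
          (Fin.castLE (Fin.last n).isLt.le j)) = τ := by
      intro x; funext j; exact h1 x j
    calc _ = ∑ x : X, (∏ i : Fin n, q i.castSucc (fun j => τ (Fin.castLE i.isLt.le j)) (τ i))
              * q (Fin.last n) τ x := by
            refine Finset.sum_congr rfl fun x _ => ?_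
            congr 1
            · refine Finset.prod_congr rfl fun i _ => ?_
              exact congrArg₂ (q i.castSucc) (h3 x i) (h1 x i)
            · exact congrArg₂ (q (Fin.last n)) (h4 x) (h2 x)
      _ = _ := by
            rw [← Finset.mul_sum, hq, mul_one]
            rfl

/-- The dynamics of a finite-horizon episodic MDP with states `S`, actions `A` and horizon `H`:
the initial state and the transition function, where `trans h s a s'` is the probability
`p_h(s' | s, a)`. Steps are numbered `0, …, H - 1`. -/
structure MDP (S A : Type*) (H : ℕ) [Fintype S] where
  init : S
  trans : Fin H → S → A → S → ℝ
  trans_nonneg : ∀ h s a s', 0 ≤ trans h s a s'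
  trans_sum : ∀ h s a, ∑ s', trans h s a s' = 1

/-- A (Markov, stochastic) policy: `prob h s a` is the probability `π_h(a | s)`. -/
structure Policy (S A : Type*) (H : ℕ) [Fintype A] where
  prob : Fin H → S → A → ℝ
  prob_nonneg : ∀ h s a, 0 ≤ prob h s a
  prob_sum : ∀ h s, ∑ a, prob h s a = 1

/-- A trajectory `(s_h, a_h)_h` of one episode. -/
abbrev Traj (S A : Type*) (H : ℕ) : Type _ := Fin H → S × A

/-- A cost function `ℓ_h(s, a)` of one episode. -/
abbrev Cost (S A : Type*) (H : ℕ) : Type _ := Fin H → S → A → ℝ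

/-- What the learner observes in one episode: the trajectory and one real number, the aggregate
loss. -/
abbrev Observation (S A : Type*) (H : ℕ) : Type _ := Traj S A H × ℝ

section Episode

variable {S A : Type*} {H : ℕ} [Fintype S] [Fintype A] [DecidableEq S] [DecidableEq A]

/-- The probability that the state at step `h` is `s`, given the steps before `h`. -/
def arrivalProb (M : MDP S A H) : (h : Fin H) → (Fin h → S × A) → S → ℝ
  | ⟨0, _⟩, _, s => if s = M.init then 1 else 0
  | ⟨j + 1, hj⟩, past, s =>
      M.trans ⟨j, Nat.lt_of_succ_lt hj⟩ (past (Fin.last j)).1 (past (Fin.last j)).2 s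

/-- The probability of the step `(s_h, a_h) = x`, given the steps before `h`. -/
def stepProb (M : MDP S A H) (π : Policy S A H) (h : Fin H) (past : Fin h → S × A)
    (x : S × A) : ℝ :=
  arrivalProb M h past x.1 * π.prob h x.1 x.2

/-- The probability of the trajectory `τ` under the policy `π`, starting in the initial state. -/
def trajProb (M : MDP S A H) (π : Policy S A H) (τ : Traj S A H) : ℝ :=
  ∏ h : Fin H, stepProb M π h (fun j => τ (Fin.castLE h.isLt.le j)) (τ h)

/-- The aggregate loss `L_{1:H}` of a trajectory. -/
def totalCost (ℓ : Cost S A H) (τ : Traj S A H) : ℝ :=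
  ∑ h, ℓ h (τ h).1 (τ h).2

/-- The value `V_1^π(s_init; ℓ)`: the expected total cost of `π` in one episode. -/
def value (M : MDP S A H) (π : Policy S A H) (ℓ : Cost S A H) : ℝ :=
  ∑ τ : Traj S A H, trajProb M π τ * totalCost ℓ τ

/-- The occupancy measure `μ_h^π(s, a)`: the probability that `(s_h, a_h) = (s, a)`. -/
def occ (M : MDP S A H) (π : Policy S A H) (h : Fin H) (s : S) (a : A) : ℝ :=
  ∑ τ : Traj S A H, if τ h = (s, a) then trajProb M π τ else 0

/-- The state occupancy measure `μ_h^π(s)`. -/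
def stateOcc (M : MDP S A H) (π : Policy S A H) (h : Fin H) (s : S) : ℝ :=
  ∑ a, occ M π h s a

/-- The importance-weighted estimate of the `U`-function, from one observation. -/
def uHat (M : MDP S A H) (γ : ℝ) (π : Policy S A H) (o : Observation S A H)
    (h : Fin H) (s : S) (a : A) : ℝ :=
  (if o.1 h = (s, a) then 1 else 0) / (occ M π h s a + γ) * o.2

/-- The loss `b_h(s)` that the bonus accumulates. -/
def bonusLoss (M : MDP S A H) (γ : ℝ) (π : Policy S A H) (h : Fin H) (s : S) : ℝ :=
  ∑ a, 3 * γ * (H : ℝ) * π.prob h s a / (stateOcc M π h s * π.prob h s a + γ)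

/-- The bonus `B_h(s, a)`, by the Bellman equations backwards from `B = 0` after the last step. -/
def bonus (M : MDP S A H) (γ : ℝ) (π : Policy S A H) (h : ℕ) (s : S) (a : A) : ℝ :=
  if hh : h < H then
    bonusLoss M γ π ⟨h, hh⟩ s +
      (if hn : h + 1 < H then
        ∑ s', ∑ a', M.trans ⟨h, hh⟩ s a s' * π.prob ⟨h + 1, hn⟩ s' a' * bonus M γ π (h + 1) s' a'
      else 0)
  else 0
termination_by H - h

/-- The unnormalized weight in the multiplicative weights update. -/
def mwWeight (M : MDP S A H) (η γ : ℝ) (π : Policy S A H) (o : Observation S A H)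
    (h : Fin H) (s : S) (a : A) : ℝ :=
  π.prob h s a * Real.exp (-η * (uHat M γ π o h s a - bonus M γ π h s a))

theorem mwWeight_nonneg (M : MDP S A H) (η γ : ℝ) (π : Policy S A H) (o : Observation S A H)
    (h : Fin H) (s : S) (a : A) : 0 ≤ mwWeight M η γ π o h s a :=
  mul_nonneg (π.prob_nonneg h s a) (Real.exp_pos _).le

theorem sum_mwWeight_pos (M : MDP S A H) (η γ : ℝ) (π : Policy S A H) (o : Observation S A H)
    (h : Fin H) (s : S) : 0 < ∑ a, mwWeight M η γ π o h s a := by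
  have hex : ∃ a, 0 < π.prob h s a := by
    by_contra! hc
    have h1 := π.prob_sum h s
    have h2 : ∑ a, π.prob h s a ≤ 0 := Finset.sum_nonpos fun a _ => hc a
    linarith
  obtain ⟨a, ha⟩ := hex
  exact Finset.sum_pos' (fun a _ => mwWeight_nonneg M η γ π o h s a)
    ⟨a, Finset.mem_univ a, mul_pos ha (Real.exp_pos _)⟩

/-- The policy improvement step of the algorithm. -/
def mwUpdate (M : MDP S A H) (η γ : ℝ) (π : Policy S A H) (o : Observation S A H) :
    Policy S A H where
  prob h s a := mwWeight M η γ π o h s a / ∑ a', mwWeight M η γ π o h s a'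
  prob_nonneg h s a :=
    div_nonneg (mwWeight_nonneg M η γ π o h s a) (sum_mwWeight_pos M η γ π o h s).le
  prob_sum h s := by
    rw [← Finset.sum_div, div_self (sum_mwWeight_pos M η γ π o h s).ne']

end Episode

/-- The policy with `π_h(a | s) = 1 / |A|`. -/
def uniformPolicy (S A : Type*) (H : ℕ) [Fintype A] [Nonempty A] : Policy S A H where
  prob _ _ _ := 1 / (Fintype.card A : ℝ)
  prob_nonneg _ _ _ := by positivity
  prob_sum _ _ := by simp

section Learning

variable {S A : Type*} {H : ℕ} [Fintype S] [Fintype A] [DecidableEq S] [DecidableEq A]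
  [Nonempty A]

/-- The algorithm: its policy after the observations of `k` episodes. -/
def algPolicy (M : MDP S A H) (η γ : ℝ) : (k : ℕ) → (Fin k → Observation S A H) → Policy S A H
  | 0, _ => uniformPolicy S A H
  | k + 1, o => mwUpdate M η γ (algPolicy M η γ k fun i => o i.castSucc) (o (Fin.last k))

variable {K : ℕ}

/-- The policy played in episode `k`, given the trajectories of the earlier episodes: the learner
observes these and the aggregate losses along them. -/
def playedPolicy (M : MDP S A H) (η γ : ℝ) (ℓ : Fin K → Cost S A H) (k : Fin K)
    (past : Fin k → Traj S A H) : Policy S A H :=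
  algPolicy M η γ k fun i => (past i, totalCost (ℓ (Fin.castLE k.isLt.le i)) (past i))

/-- The policy `π^k` in a run `ω` of the `K` episodes. -/
def runPolicy (M : MDP S A H) (η γ : ℝ) (ℓ : Fin K → Cost S A H) (ω : Fin K → Traj S A H)
    (k : Fin K) : Policy S A H :=
  playedPolicy M η γ ℓ k fun i => ω (Fin.castLE k.isLt.le i)

/-- The probability of the run `ω`: the trajectory of episode `k` is drawn with `π^k`, given the
earlier episodes. -/
def runProb (M : MDP S A H) (η γ : ℝ) (ℓ : Fin K → Cost S A H) (ω : Fin K → Traj S A H) : ℝ :=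
  ∏ k : Fin K, trajProb M (runPolicy M η γ ℓ ω k) (ω k)

/-- The regret `R_K` of the run `ω` against the best fixed policy in hindsight. -/
def regret (M : MDP S A H) (η γ : ℝ) (ℓ : Fin K → Cost S A H) (ω : Fin K → Traj S A H) : ℝ :=
  ∑ k, value M (runPolicy M η γ ℓ ω k) (ℓ k) - ⨅ π : Policy S A H, ∑ k, value M π (ℓ k)

end Learning

section Law

variable {S A : Type*} {H : ℕ} [Fintype S] [DecidableEq S]

theorem arrivalProb_nonneg (M : MDP S A H) : ∀ (h : Fin H) (past : Fin h → S × A) (s : S),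
    0 ≤ arrivalProb M h past s
  | ⟨0, _⟩, _, s => by unfold arrivalProb; positivity
  | ⟨_ + 1, _⟩, _, _ => M.trans_nonneg _ _ _ _

theorem sum_arrivalProb (M : MDP S A H) : ∀ (h : Fin H) (past : Fin h → S × A),
    ∑ s, arrivalProb M h past s = 1
  | ⟨0, _⟩, _ => by simp [arrivalProb]
  | ⟨_ + 1, _⟩, _ => M.trans_sum _ _ _

variable [Fintype A]

theorem trajProb_nonneg (M : MDP S A H) (π : Policy S A H) (τ : Traj S A H) :
    0 ≤ trajProb M π τ :=
  Finset.prod_nonneg fun h _ =>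
    mul_nonneg (arrivalProb_nonneg M h _ _) (π.prob_nonneg h _ _)

theorem sum_trajProb (M : MDP S A H) (π : Policy S A H) : ∑ τ, trajProb M π τ = 1 := by
  refine sum_prod_sequential H (stepProb M π) fun h past => ?_
  simp only [stepProb, Fintype.sum_prod_type]
  simp only [← Finset.mul_sum, π.prob_sum, mul_one]
  exact sum_arrivalProb M h past

variable [DecidableEq A] [Nonempty A] {K : ℕ}

theorem runProb_nonneg (M : MDP S A H) (η γ : ℝ) (ℓ : Fin K → Cost S A H)
    (ω : Fin K → Traj S A H) : 0 ≤ runProb M η γ ℓ ω :=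
  Finset.prod_nonneg fun _ _ => trajProb_nonneg M _ _

theorem sum_runProb (M : MDP S A H) (η γ : ℝ) (ℓ : Fin K → Cost S A H) :
    ∑ ω, runProb M η γ ℓ ω = 1 :=
  sum_prod_sequential K (fun k past τ => trajProb M (playedPolicy M η γ ℓ k past) τ)
    fun _ _ => sum_trajProb M _

/-- The law of the `K` trajectories when the algorithm interacts with the MDP for `K` episodes. -/
def runLaw (M : MDP S A H) (η γ : ℝ) (ℓ : Fin K → Cost S A H) : PMF (Fin K → Traj S A H) :=
  PMF.ofFintype (fun ω => ENNReal.ofReal (runProb M η γ ℓ ω)) (by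
    rw [← ENNReal.ofReal_sum_of_nonneg fun ω _ => runProb_nonneg M η γ ℓ ω, sum_runProb,
      ENNReal.ofReal_one])

/-- The probability of an event about the run (every set of runs is an event). -/
def runMeasure (M : MDP S A H) (η γ : ℝ) (ℓ : Fin K → Cost S A H) :
    @MeasureTheory.Measure (Fin K → Traj S A H) ⊤ :=
  @PMF.toMeasure (Fin K → Traj S A H) ⊤ (runLaw M η γ ℓ)

end Law

/-- The learning rate `η = (H √(SAK) + H² √K)⁻¹`. -/
def learningRate (S A H K : ℕ) : ℝ :=
  ((H : ℝ) * √((S : ℝ) * A * K) + (H : ℝ) ^ 2 * √(K : ℝ))⁻¹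

end AggregateBandit

end

/-!
The expected aggregate loss given the state and action at step `h` is the `U`-function, which is
the `Q`-function plus a function of the state alone, by the Markov property. Advantages of `U` are
therefore advantages of `Q`, and the performance difference formula (`value_sub_value`) bounds the
regret by advantages of `U` along an episode played with the comparator. Bounding them separately
at each `(h, s, a)` makes the high probability event independent of the comparator.

At `(h, s, a)` the losses `uHat - bonus` are fed to multiplicative weights
(`run_multiplicativeWeights`). The estimator is biased downwards by the implicit exploration
parameter `γ`, so `∑ₖ (uHat - uFun)` has exponential moment at most one at scale `γ / H`
(`episodeMean_exp_uHat_sub_le_one`); the deviation of `uFun - uHat` averaged over the played policy,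
plus the second order term `η π uHat²` of multiplicative weights, has exponential moment at most one
after subtracting `2 / 3` of the bonus loss `b` (`episodeMean_exp_average_le_one`). The `2 / 3`
consists of the bias `1 / 3` and the two second order terms, `1 / 6` each. These moments multiply
along a run (`sum_prod_sequential_le_one`), and Markov's inequality with a union bound over the
`H S + H S A` quantities gives the good event (`one_sub_le_sum_runProb`).

On it, the advantages for the costs `ℓ - b` sum to at most `D + ∑ₖ bₕ(s)` (`sum_advantage_le`),
because the bonus is the `Q`-function of `b`. Averaging over the comparator's episode, the
comparator's own value of `b` appears on both sides and cancels, and the regret is at most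
`H D + ∑ₖ value πᵏ bᵏ`. The last sum is small, as `πᵏ` sees its own bonus losses under its own
occupancy measure (`value_bonusLoss_le`). The multiplicative weights analysis needs `η B ≤ 1`,
where `B ≤ 3 H²`; this holds from nine episodes on, and for fewer the trivial bound `K H` is enough.
-/

noncomputable section

namespace AggregateBandit

/-! ### Sequential sampling -/

section Sequential

variable {X : Type*} [Fintype X]

/-- Splitting off the last coordinate of a sequentially sampled tuple. -/
theorem sum_prod_sequential_succ (n : ℕ) (q : (i : Fin (n + 1)) → (Fin i → X) → X → ℝ)
    (F : (Fin (n + 1) → X) → ℝ) :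
    ∑ τ : Fin (n + 1) → X, (∏ i, q i (fun j => τ (Fin.castLE i.isLt.le j)) (τ i)) * F τ =
      ∑ τ : Fin n → X, (∏ i : Fin n, q i.castSucc (fun j => τ (Fin.castLE i.isLt.le j)) (τ i)) *
        ∑ x, q (Fin.last n) τ x * F (Fin.snoc (α := fun _ => X) τ x) := by
  rw [← (Fin.snocEquiv (fun _ : Fin (n + 1) => X)).sum_comp, Fintype.sum_prod_type_right]
  refine Finset.sum_congr rfl fun τ _ => ?_
  rw [Finset.mul_sum]
  refine Finset.sum_congr rfl fun x _ => ?_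
  have h1 : ∀ i : Fin n,
      (Fin.snocEquiv (fun _ : Fin (n + 1) => X)) (x, τ) i.castSucc = τ i := by
    intro i; simp [Fin.snocEquiv]
  have h2 : (Fin.snocEquiv (fun _ : Fin (n + 1) => X)) (x, τ) (Fin.last n) = x := by
    simp [Fin.snocEquiv]
  have h0 : (Fin.snocEquiv (fun _ : Fin (n + 1) => X)) (x, τ)
      = Fin.snoc (α := fun _ => X) τ x := rfl
  rw [Fin.prod_univ_castSucc, ← mul_assoc]
  congr 1
  congr 1
  · refine Finset.prod_congr rfl fun i _ => ?_
    exact congrArg₂ (q i.castSucc) (funext fun j => h1 (Fin.castLE i.isLt.le j)) (h1 i)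
  · exact congrArg₂ (q (Fin.last n)) (funext fun j => h1 j) h2

/-- Sequentially multiplied nonnegative kernels of mass at most one have total mass at most one:
the supermartingale property behind the exponential tail bounds. -/
theorem sum_prod_sequential_le_one :
    ∀ (n : ℕ) (q : (i : Fin n) → (Fin i → X) → X → ℝ), (∀ i past x, 0 ≤ q i past x) →
      (∀ i past, ∑ x, q i past x ≤ 1) →
      ∑ τ : Fin n → X, ∏ i : Fin n, q i (fun j => τ (Fin.castLE i.isLt.le j)) (τ i) ≤ 1
  | 0, _, _, _ => by simp
  | n + 1, q, hq0, hq => by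
    have ih := sum_prod_sequential_le_one n (fun i => q i.castSucc)
      (fun i past x => hq0 i.castSucc past x) (fun i past => hq i.castSucc past)
    have h := sum_prod_sequential_succ n q fun _ => 1
    simp only [mul_one] at h
    rw [h]
    refine le_trans (Finset.sum_le_sum fun τ _ => ?_) ih
    exact mul_le_of_le_one_right (Finset.prod_nonneg fun i _ => hq0 _ _ _) (hq (Fin.last n) τ)

/-- The tower property: given the earlier coordinates, coordinate `h` is distributed
according to `q h`. -/
theorem sum_prod_sequential_tower :
    ∀ (n : ℕ) (q : (i : Fin n) → (Fin i → X) → X → ℝ), (∀ i past, ∑ x, q i past x = 1) →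
      ∀ (h : Fin n) (F : (Fin h → X) → X → ℝ),
      ∑ τ : Fin n → X, (∏ i, q i (fun j => τ (Fin.castLE i.isLt.le j)) (τ i)) *
          F (fun j => τ (Fin.castLE h.isLt.le j)) (τ h) =
        ∑ τ : Fin n → X, (∏ i, q i (fun j => τ (Fin.castLE i.isLt.le j)) (τ i)) *
          ∑ x, q h (fun j => τ (Fin.castLE h.isLt.le j)) x *
            F (fun j => τ (Fin.castLE h.isLt.le j)) x
  | 0, _, _, h, _ => h.elim0
  | n + 1, q, hq, h, F => by
    have hsnoc : ∀ (τ : Fin n → X) (x : X) (i : Fin n) (hi : (i : ℕ) < n + 1),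
        Fin.snoc (α := fun _ => X) τ x ⟨i, hi⟩ = τ i := fun τ x i _ =>
      Fin.snoc_castSucc (α := fun _ => X) x τ i
    rw [sum_prod_sequential_succ, sum_prod_sequential_succ n q fun τ =>
      ∑ x, q h (fun j => τ (Fin.castLE h.isLt.le j)) x * F (fun j => τ (Fin.castLE h.isLt.le j)) x]
    induction h using Fin.lastCases with
    | last =>
      have hpast : ∀ (τ : Fin n → X) (x : X), (fun j : Fin (Fin.last n) =>
          Fin.snoc (α := fun _ => X) τ x (Fin.castLE (Fin.last n).isLt.le j)) = τ := fun τ x =>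
        funext fun j => hsnoc τ x j _
      refine Finset.sum_congr rfl fun τ _ => ?_
      simp only [hpast, Fin.snoc_last]
      rw [← Finset.sum_mul, hq, one_mul]
    | cast h =>
      have hpast : ∀ (τ : Fin n → X) (x : X), (fun j : Fin h.castSucc =>
          Fin.snoc (α := fun _ => X) τ x (Fin.castLE h.castSucc.isLt.le j)) =
            fun j => τ (Fin.castLE h.isLt.le j) := fun τ x =>
        funext fun j => hsnoc τ x (Fin.castLE h.isLt.le j) _
      simp only [hpast, Fin.snoc_castSucc]
      simp only [← Finset.sum_mul, hq, one_mul]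
      exact sum_prod_sequential_tower n (fun i => q i.castSucc) (fun i => hq i.castSucc) h F

end Sequential

section Trajectories

variable {S A : Type*} {H : ℕ} [Fintype S] [Fintype A] [DecidableEq S]

/-- The expectation of `f` over an episode played with `π`. -/
def episodeMean (M : MDP S A H) (π : Policy S A H) (f : Traj S A H → ℝ) : ℝ :=
  ∑ τ, trajProb M π τ * f τ

theorem episodeMean_add (M : MDP S A H) (π : Policy S A H) (f g : Traj S A H → ℝ) :
    episodeMean M π (fun τ => f τ + g τ) = episodeMean M π f + episodeMean M π g := by
  simp only [episodeMean, mul_add, Finset.sum_add_distrib]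

theorem episodeMean_sub (M : MDP S A H) (π : Policy S A H) (f g : Traj S A H → ℝ) :
    episodeMean M π (fun τ => f τ - g τ) = episodeMean M π f - episodeMean M π g := by
  simp only [episodeMean, mul_sub, Finset.sum_sub_distrib]

theorem episodeMean_const_mul (M : MDP S A H) (π : Policy S A H) (c : ℝ) (f : Traj S A H → ℝ) :
    episodeMean M π (fun τ => c * f τ) = c * episodeMean M π f := by
  simp only [episodeMean, Finset.mul_sum]
  exact Finset.sum_congr rfl fun _ _ => by ring

theorem episodeMean_const (M : MDP S A H) (π : Policy S A H) (c : ℝ) :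
    episodeMean M π (fun _ => c) = c := by
  simp only [episodeMean, ← Finset.sum_mul, sum_trajProb, one_mul]

theorem episodeMean_sum (M : MDP S A H) (π : Policy S A H) {ι : Type*} (t : Finset ι)
    (f : ι → Traj S A H → ℝ) :
    episodeMean M π (fun τ => ∑ i ∈ t, f i τ) = ∑ i ∈ t, episodeMean M π (f i) := by
  simp only [episodeMean, Finset.mul_sum]
  exact Finset.sum_comm

theorem episodeMean_mono (M : MDP S A H) (π : Policy S A H) {f g : Traj S A H → ℝ}
    (hfg : ∀ τ, f τ ≤ g τ) : episodeMean M π f ≤ episodeMean M π g :=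
  Finset.sum_le_sum fun τ _ => mul_le_mul_of_nonneg_left (hfg τ) (trajProb_nonneg M π τ)

theorem episodeMean_nonneg (M : MDP S A H) (π : Policy S A H) {f : Traj S A H → ℝ}
    (hf : ∀ τ, 0 ≤ f τ) : 0 ≤ episodeMean M π f :=
  Finset.sum_nonneg fun τ _ => mul_nonneg (trajProb_nonneg M π τ) (hf τ)

/-- Conditioning on the steps before `h`: if `G` is determined by them, then the state at step `h`
may be averaged over its arrival probabilities and the action over the policy. -/
theorem episodeMean_tower (M : MDP S A H) (π : Policy S A H) (h : Fin H) {G : Traj S A H → ℝ}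
    (hG : DependsOn G (Set.Iio h)) (f : S → A → ℝ) :
    episodeMean M π (fun τ => G τ * f (τ h).1 (τ h).2) =
      episodeMean M π (fun τ => G τ *
        ∑ s, arrivalProb M h (fun j => τ (Fin.castLE h.isLt.le j)) s *
          ∑ a, π.prob h s a * f s a) := by
  rcases isEmpty_or_nonempty (S × A) with hX | ⟨⟨x₀⟩⟩
  · have : IsEmpty (Traj S A H) := ⟨fun τ => hX.false (τ h)⟩
    simp [episodeMean]
  -- `G` as a function of the earlier steps: fill up the later ones arbitrarily.
  let G' : (Fin h → S × A) → ℝ := fun past =>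
    G fun j => if hj : j < h then past ⟨j, hj⟩ else x₀
  have hG' : ∀ τ : Traj S A H, G τ = G' fun j => τ (Fin.castLE h.isLt.le j) := by
    intro τ
    refine hG fun j hj => ?_
    simp only [dif_pos (Set.mem_Iio.mp hj)]
    rfl
  have key := sum_prod_sequential_tower H (stepProb M π) (fun h past => by
    simp only [stepProb, Fintype.sum_prod_type, ← Finset.mul_sum, π.prob_sum, mul_one]
    exact sum_arrivalProb M h past) h fun past x => G' past * f x.1 x.2
  simp only [episodeMean, hG']
  refine key.trans (Finset.sum_congr rfl fun τ _ => ?_)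
  simp only [trajProb]
  congr 1
  simp only [stepProb, Fintype.sum_prod_type, Finset.mul_sum]
  exact Finset.sum_congr rfl fun s _ => Finset.sum_congr rfl fun a _ => by ring

/-- The action at step `h` may be averaged over the policy. -/
theorem episodeMean_average_action (M : MDP S A H) (π : Policy S A H) (h : Fin H)
    {G : Traj S A H → ℝ} (hG : DependsOn G (Set.Iio h)) (f : S → A → ℝ) :
    episodeMean M π (fun τ => G τ * f (τ h).1 (τ h).2) =
      episodeMean M π (fun τ => G τ * ∑ a, π.prob h (τ h).1 a * f (τ h).1 a) := by
  rw [episodeMean_tower M π h hG f,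
    episodeMean_tower M π h hG fun s _ => ∑ a, π.prob h s a * f s a]
  simp only [← Finset.sum_mul, π.prob_sum, one_mul]

/-- The next state may be averaged over the transition function. -/
theorem episodeMean_average_next (M : MDP S A H) (π : Policy S A H) {j : ℕ} (hj : j + 1 < H)
    {G : Traj S A H → ℝ} (hG : DependsOn G (Set.Iio (⟨j + 1, hj⟩ : Fin H))) (v : S → ℝ) :
    episodeMean M π (fun τ => G τ * v (τ ⟨j + 1, hj⟩).1) =
      episodeMean M π (fun τ => G τ * ∑ s', M.trans ⟨j, Nat.lt_of_succ_lt hj⟩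
        (τ ⟨j, Nat.lt_of_succ_lt hj⟩).1 (τ ⟨j, Nat.lt_of_succ_lt hj⟩).2 s' * v s') := by
  rw [episodeMean_tower M π ⟨j + 1, hj⟩ hG fun s _ => v s]
  simp only [← Finset.sum_mul, π.prob_sum, one_mul]
  rfl

end Trajectories

/-! ### Costs along a trajectory -/

section Costs

variable {S A : Type*} {H : ℕ}

/-- The cost of the steps before `h`. -/
def pastCost (ℓ : Cost S A H) (h : Fin H) (τ : Traj S A H) : ℝ :=
  ∑ i, if i < h then ℓ i (τ i).1 (τ i).2 else 0

/-- The cost of the steps from `h` on. -/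
def futureCost (ℓ : Cost S A H) (h : ℕ) (τ : Traj S A H) : ℝ :=
  ∑ i : Fin H, if h ≤ i then ℓ i (τ i).1 (τ i).2 else 0

theorem totalCost_eq_pastCost_add (ℓ : Cost S A H) (h : Fin H) (τ : Traj S A H) :
    totalCost ℓ τ = pastCost ℓ h τ + futureCost ℓ h τ := by
  rw [totalCost, pastCost, futureCost, ← Finset.sum_add_distrib]
  refine Finset.sum_congr rfl fun i _ => ?_
  by_cases hi : i < h
  · have : ¬ (h : ℕ) ≤ i := by simpa using hi
    simp [hi, this]
  · have : (h : ℕ) ≤ i := by simpa using hi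
    simp [hi, this]

theorem futureCost_eq_add (ℓ : Cost S A H) {h : ℕ} (hh : h < H) (τ : Traj S A H) :
    futureCost ℓ h τ = ℓ ⟨h, hh⟩ (τ ⟨h, hh⟩).1 (τ ⟨h, hh⟩).2 + futureCost ℓ (h + 1) τ := by
  have h1 : ℓ ⟨h, hh⟩ (τ ⟨h, hh⟩).1 (τ ⟨h, hh⟩).2 =
      ∑ i : Fin H, if i = ⟨h, hh⟩ then ℓ i (τ i).1 (τ i).2 else 0 := by simp
  rw [h1, futureCost, futureCost, ← Finset.sum_add_distrib]
  refine Finset.sum_congr rfl fun i _ => ?_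
  simp only [Fin.ext_iff]
  split_ifs <;> first | omega | simp

theorem pastCost_mem_Icc {ℓ : Cost S A H} (hℓ : ∀ h s a, ℓ h s a ∈ Set.Icc (0 : ℝ) 1)
    (h : Fin H) (τ : Traj S A H) : pastCost ℓ h τ ∈ Set.Icc (0 : ℝ) h := by
  constructor
  · exact Finset.sum_nonneg fun i _ => by split_ifs; exacts [(hℓ _ _ _).1, le_rfl]
  · calc pastCost ℓ h τ ≤ ∑ i : Fin H, if i < h then (1 : ℝ) else 0 :=
          Finset.sum_le_sum fun i _ => by split_ifs; exacts [(hℓ _ _ _).2, le_rfl]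
      _ = h := by
          rw [Finset.sum_boole, Finset.filter_gt_eq_Iio, Fin.card_Iio]

theorem totalCost_mem_Icc {ℓ : Cost S A H} (hℓ : ∀ h s a, ℓ h s a ∈ Set.Icc (0 : ℝ) 1)
    (τ : Traj S A H) : totalCost ℓ τ ∈ Set.Icc (0 : ℝ) H := by
  constructor
  · exact Finset.sum_nonneg fun i _ => (hℓ _ _ _).1
  · calc totalCost ℓ τ ≤ ∑ _i : Fin H, (1 : ℝ) := Finset.sum_le_sum fun i _ => (hℓ _ _ _).2
      _ = H := by simp

theorem dependsOn_pastCost (ℓ : Cost S A H) (h : Fin H) :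
    DependsOn (pastCost ℓ h) (Set.Iio h) := by
  intro τ τ' hτ
  refine Finset.sum_congr rfl fun i _ => ?_
  split_ifs with hi
  · rw [hτ i hi]
  · rfl

theorem dependsOn_visit [DecidableEq S] [DecidableEq A] (h : Fin H) (s : S) (a : A) :
    DependsOn (fun τ : Traj S A H => if τ h = (s, a) then (1 : ℝ) else 0) (Set.Iic h) := by
  intro τ τ' hτ
  simp only [hτ h (Set.mem_Iic.mpr le_rfl)]

end Costs

/-! ### Value functions and the performance difference formula -/

section Values

variable {S A : Type*} {H : ℕ} [Fintype S] [Fintype A]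

/-- The `Q`-function of `π` for the costs `c`, by the Bellman equations; zero from step `H` on. -/
def qFun (M : MDP S A H) (π : Policy S A H) (c : Cost S A H) (h : ℕ) (s : S) (a : A) : ℝ :=
  if hh : h < H then
    c ⟨h, hh⟩ s a +
      (if hn : h + 1 < H then
        ∑ s', ∑ a', M.trans ⟨h, hh⟩ s a s' * π.prob ⟨h + 1, hn⟩ s' a' * qFun M π c (h + 1) s' a'
      else 0)
  else 0
termination_by H - h

/-- The average of the `Q`-function over the actions of the policy. -/
def vFun (M : MDP S A H) (π : Policy S A H) (c : Cost S A H) (h : Fin H) (s : S) : ℝ :=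
  ∑ a, π.prob h s a * qFun M π c h s a

theorem qFun_eq (M : MDP S A H) (π : Policy S A H) (c : Cost S A H) {h : ℕ} (hh : h < H)
    (s : S) (a : A) :
    qFun M π c h s a = c ⟨h, hh⟩ s a +
      if hn : h + 1 < H then ∑ s', M.trans ⟨h, hh⟩ s a s' * vFun M π c ⟨h + 1, hn⟩ s' else 0 := by
  rw [qFun, dif_pos hh]
  simp only [vFun, Finset.mul_sum, mul_assoc]

theorem qFun_of_le (M : MDP S A H) (π : Policy S A H) (c : Cost S A H) {h : ℕ} (hh : H ≤ h)
    (s : S) (a : A) : qFun M π c h s a = 0 := by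
  rw [qFun, dif_neg (by omega)]

theorem vFun_mem_Icc (M : MDP S A H) (π : Policy S A H) (c : Cost S A H) (h : Fin H) (s : S)
    {r : ℝ} (hq : ∀ a, qFun M π c h s a ∈ Set.Icc 0 r) : vFun M π c h s ∈ Set.Icc 0 r := by
  refine ⟨Finset.sum_nonneg fun a _ => mul_nonneg (π.prob_nonneg h s a) (hq a).1, ?_⟩
  calc vFun M π c h s ≤ ∑ a, π.prob h s a * r :=
        Finset.sum_le_sum fun a _ => mul_le_mul_of_nonneg_left (hq a).2 (π.prob_nonneg h s a)
    _ = r := by rw [← Finset.sum_mul, π.prob_sum, one_mul]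

theorem qFun_mem_Icc (M : MDP S A H) (π : Policy S A H) (c : Cost S A H) {r : ℝ}
    (hc : ∀ h s a, c h s a ∈ Set.Icc 0 r) :
    ∀ (n h : ℕ), h + n = H → ∀ s a, qFun M π c h s a ∈ Set.Icc 0 (n * r)
  | 0, h, hn, s, a => by simp [qFun_of_le M π c (by omega : H ≤ h)]
  | n + 1, h, hn, s, a => by
    have hh : h < H := by omega
    have ih := qFun_mem_Icc M π c hc n (h + 1) (by omega)
    have hr : 0 ≤ r := (hc ⟨h, hh⟩ s a).1.trans (hc ⟨h, hh⟩ s a).2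
    rw [qFun_eq M π c hh]
    have hrest : (if hn : h + 1 < H then
        ∑ s', M.trans ⟨h, hh⟩ s a s' * vFun M π c ⟨h + 1, hn⟩ s' else 0) ∈ Set.Icc 0 (n * r) := by
      split_ifs with hn'
      · have hv : ∀ s', vFun M π c ⟨h + 1, hn'⟩ s' ∈ Set.Icc 0 (n * r) := fun s' =>
          vFun_mem_Icc M π c ⟨h + 1, hn'⟩ s' fun a' => ih s' a'
        refine ⟨Finset.sum_nonneg fun s' _ => mul_nonneg (M.trans_nonneg _ _ _ _) (hv s').1, ?_⟩
        calc _ ≤ ∑ s', M.trans ⟨h, hh⟩ s a s' * (n * r) := Finset.sum_le_sum fun s' _ =>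
              mul_le_mul_of_nonneg_left (hv s').2 (M.trans_nonneg _ _ _ _)
          _ = n * r := by rw [← Finset.sum_mul, M.trans_sum, one_mul]
      · exact ⟨le_rfl, by positivity⟩
    have h1 := hc ⟨h, hh⟩ s a
    push_cast
    exact ⟨add_nonneg h1.1 hrest.1, by linarith [h1.2, hrest.2]⟩

variable [DecidableEq S]

theorem value_eq_episodeMean (M : MDP S A H) (π : Policy S A H) (c : Cost S A H) :
    value M π c = episodeMean M π (totalCost c) := rfl

/-- One step of the Bellman equations of `π`, along an episode played with a possibly different
policy `π'`. -/
theorem episodeMean_mul_qFun (M : MDP S A H) (π π' : Policy S A H) (c : Cost S A H)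
    {h : ℕ} (hh : h < H) {G : Traj S A H → ℝ} (hG : DependsOn G (Set.Iic (⟨h, hh⟩ : Fin H))) :
    episodeMean M π' (fun τ => G τ * qFun M π c h (τ ⟨h, hh⟩).1 (τ ⟨h, hh⟩).2) =
      episodeMean M π' (fun τ => G τ * c ⟨h, hh⟩ (τ ⟨h, hh⟩).1 (τ ⟨h, hh⟩).2) +
        if hn : h + 1 < H then
          episodeMean M π' (fun τ => G τ * vFun M π c ⟨h + 1, hn⟩ (τ ⟨h + 1, hn⟩).1)
        else 0 := by
  simp only [qFun_eq M π c hh, mul_add, episodeMean_add]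
  congr 1
  split_ifs with hn
  · refine (episodeMean_average_next M π' hn ?_ _).symm
    exact hG.mono fun i hi => Nat.lt_succ_of_le (Fin.le_def.mp hi)
  · simp [episodeMean]

/-- Performance difference: the value of `π'` in terms of the value functions of `π`. -/
theorem value_eq_vFun_sub (M : MDP S A H) (π π' : Policy S A H) (c : Cost S A H) (hH : 0 < H) :
    value M π' c = vFun M π c ⟨0, hH⟩ M.init -
      episodeMean M π' (fun τ => ∑ h, (vFun M π c h (τ h).1 - qFun M π c h (τ h).1 (τ h).2)) := by
  let e : ℕ → ℝ := fun h => if hh : h < H then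
    episodeMean M π' (fun τ => vFun M π c ⟨h, hh⟩ (τ ⟨h, hh⟩).1) else 0
  have hstep : ∀ h : Fin H, episodeMean M π' (fun τ => c h (τ h).1 (τ h).2) =
      (e h - e (h + 1)) -
        episodeMean M π' (fun τ => vFun M π c h (τ h).1 - qFun M π c h (τ h).1 (τ h).2) := by
    rintro ⟨h, hh⟩
    have := episodeMean_mul_qFun M π π' c hh (G := fun _ => 1) (fun _ _ _ => rfl)
    simp only [one_mul] at this
    rw [episodeMean_sub, this]
    simp only [e, dif_pos hh]
    ring
  have h0 : e 0 = vFun M π c ⟨0, hH⟩ M.init := by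
    have := episodeMean_tower M π' ⟨0, hH⟩ (G := fun _ => 1) (fun _ _ _ => rfl)
      fun s _ => vFun M π c ⟨0, hH⟩ s
    simp only [one_mul, arrivalProb, ← Finset.sum_mul, π'.prob_sum, ite_mul, zero_mul,
      Finset.sum_ite_eq', Finset.mem_univ, if_true] at this
    simp only [e, dif_pos hH, this, episodeMean_const]
  have hend : e H = 0 := by simp [e]
  have hsum : value M π' c = ∑ h, episodeMean M π' (fun τ => c h (τ h).1 (τ h).2) :=
    episodeMean_sum M π' Finset.univ fun h τ => c h (τ h).1 (τ h).2
  rw [hsum, episodeMean_sum M π' Finset.univ, Finset.sum_congr rfl fun h _ => hstep h,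
    Finset.sum_sub_distrib, Fin.sum_univ_eq_sum_range (fun h => e h - e (h + 1)) H, Finset.sum_range_sub', h0, hend,
    sub_zero]

/-- The value of the comparator falls short of the value of `π` by the expected advantages of
`π` along an episode played with the comparator. -/
theorem value_sub_value (M : MDP S A H) (π π' : Policy S A H) (c : Cost S A H) (hH : 0 < H) :
    value M π c - value M π' c =
      episodeMean M π' (fun τ => ∑ h, (vFun M π c h (τ h).1 - qFun M π c h (τ h).1 (τ h).2)) := by
  have h1 := value_eq_vFun_sub M π π' c hH
  have h2 := value_eq_vFun_sub M π π c hH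
  have h3 : episodeMean M π
      (fun τ => ∑ h, (vFun M π c h (τ h).1 - qFun M π c h (τ h).1 (τ h).2)) = 0 := by
    rw [episodeMean_sum M π Finset.univ]
    refine Finset.sum_eq_zero fun h _ => ?_
    have := episodeMean_average_action M π h (G := fun _ => 1) (fun _ _ _ => rfl)
      (qFun M π c h)
    simp only [one_mul] at this
    rw [episodeMean_sub, this]
    exact sub_self _
  linarith

/-- The mean future cost on an event about the steps up to `h` is the mean of the `Q`-function. -/
theorem episodeMean_mul_futureCost (M : MDP S A H) (π : Policy S A H) (ℓ : Cost S A H) :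
    ∀ (n h : ℕ) (hh : h < H), h + n + 1 = H → ∀ {G : Traj S A H → ℝ},
      DependsOn G (Set.Iic (⟨h, hh⟩ : Fin H)) →
      episodeMean M π (fun τ => G τ * futureCost ℓ h τ) =
        episodeMean M π (fun τ => G τ * qFun M π ℓ h (τ ⟨h, hh⟩).1 (τ ⟨h, hh⟩).2)
  | n, h, hh, hn, G, hG => by
    rw [episodeMean_mul_qFun M π π ℓ hh hG]
    simp only [futureCost_eq_add ℓ hh, mul_add, episodeMean_add]
    congr 1
    cases n with
    | zero =>
      have : ∀ τ : Traj S A H, futureCost ℓ (h + 1) τ = 0 := fun τ =>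
        Finset.sum_eq_zero fun i _ => if_neg (by omega)
      simp [this, episodeMean, show ¬ h + 1 < H by omega]
    | succ n =>
      have hn' : h + 1 < H := by omega
      have hG' : DependsOn G (Set.Iio (⟨h + 1, hn'⟩ : Fin H)) :=
        hG.mono fun i hi => Nat.lt_succ_of_le (Fin.le_def.mp hi)
      rw [dif_pos hn', episodeMean_mul_futureCost M π ℓ n (h + 1) hn' (by omega)
        (hG'.mono Set.Iio_subset_Iic_self)]
      exact episodeMean_average_action M π ⟨h + 1, hn'⟩ hG' _

theorem value_mem_Icc (M : MDP S A H) (π : Policy S A H) {c : Cost S A H}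
    (hc : ∀ h s a, c h s a ∈ Set.Icc (0 : ℝ) 1) : value M π c ∈ Set.Icc (0 : ℝ) H := by
  rw [value_eq_episodeMean]
  refine ⟨episodeMean_nonneg M π fun τ => (totalCost_mem_Icc hc τ).1, ?_⟩
  rw [← episodeMean_const M π (H : ℝ)]
  exact episodeMean_mono M π fun τ => (totalCost_mem_Icc hc τ).2

end Values

/-! ### The `U`-function -/

section UFunction

variable {S A : Type*} {H : ℕ} [Fintype S] [Fintype A] [DecidableEq S] [DecidableEq A]

/-- The occupancy measure is the mean of the visit indicator. -/
theorem occ_eq_episodeMean (M : MDP S A H) (π : Policy S A H) (h : Fin H) (s : S) (a : A) :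
    occ M π h s a = episodeMean M π (fun τ => if τ h = (s, a) then 1 else 0) := by
  simp [occ, episodeMean]

theorem occ_nonneg (M : MDP S A H) (π : Policy S A H) (h : Fin H) (s : S) (a : A) :
    0 ≤ occ M π h s a := by
  rw [occ_eq_episodeMean]
  exact episodeMean_nonneg M π fun τ => by split_ifs <;> norm_num

theorem stateOcc_eq_episodeMean (M : MDP S A H) (π : Policy S A H) (h : Fin H) (s : S) :
    stateOcc M π h s = episodeMean M π (fun τ => if (τ h).1 = s then 1 else 0) := by
  simp only [stateOcc, occ_eq_episodeMean, ← episodeMean_sum, Prod.ext_iff, ite_and]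
  congr 1
  funext τ
  split_ifs <;> simp

/-- Means of functions of step `h` in terms of the occupancy measure. -/
theorem episodeMean_eq_sum_occ (M : MDP S A H) (π : Policy S A H) (h : Fin H) (f : S → A → ℝ) :
    episodeMean M π (fun τ => f (τ h).1 (τ h).2) = ∑ s, ∑ a, occ M π h s a * f s a := by
  simp only [occ_eq_episodeMean, mul_comm _ (f _ _), ← episodeMean_const_mul, ← episodeMean_sum]
  congr 1
  funext τ
  rw [← Fintype.sum_prod_type' (f := fun s a => f s a * if τ h = (s, a) then 1 else 0)]
  simp

/-- Given the state at step `h`, the action is independent of what happened before. -/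
theorem episodeMean_mul_visit (M : MDP S A H) (π : Policy S A H) (h : Fin H) (s : S) (a : A)
    {G : Traj S A H → ℝ} (hG : DependsOn G (Set.Iio h)) :
    episodeMean M π (fun τ => G τ * if τ h = (s, a) then 1 else 0) =
      π.prob h s a * episodeMean M π (fun τ => G τ * if (τ h).1 = s then 1 else 0) := by
  have h1 := episodeMean_average_action M π h hG
    fun s' a' => if s' = s then (if a' = a then 1 else 0) else 0
  rw [← episodeMean_const_mul]
  convert h1 using 2
  · funext τ
    simp only [Prod.ext_iff, ite_and]
  · funext τ
    split_ifs with hs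
    · simp [hs, mul_comm]
    · simp

theorem occ_eq_stateOcc_mul (M : MDP S A H) (π : Policy S A H) (h : Fin H) (s : S) (a : A) :
    occ M π h s a = stateOcc M π h s * π.prob h s a := by
  have := episodeMean_mul_visit M π h s a (G := fun _ => 1) (fun _ _ _ => rfl)
  simp only [one_mul] at this
  rw [occ_eq_episodeMean, stateOcc_eq_episodeMean, this, mul_comm]

/-- The expected cost before step `h`, given that the state at step `h` is `s`; it is zero, by
division by zero, if `s` is not reached. -/
def wFun (M : MDP S A H) (π : Policy S A H) (ℓ : Cost S A H) (h : Fin H) (s : S) : ℝ :=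
  episodeMean M π (fun τ => pastCost ℓ h τ * if (τ h).1 = s then 1 else 0) / stateOcc M π h s

/-- The `U`-function: the expected total cost of an episode, given the state and the action at
step `h`. It differs from the `Q`-function by a function of the state alone. -/
def uFun (M : MDP S A H) (π : Policy S A H) (ℓ : Cost S A H) (h : Fin H) (s : S) (a : A) : ℝ :=
  qFun M π ℓ h s a + wFun M π ℓ h s

theorem stateOcc_nonneg (M : MDP S A H) (π : Policy S A H) (h : Fin H) (s : S) :
    0 ≤ stateOcc M π h s :=
  Finset.sum_nonneg fun a _ => occ_nonneg M π h s a

theorem episodeMean_pastCost_mem_Icc (M : MDP S A H) (π : Policy S A H) {ℓ : Cost S A H}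
    (hℓ : ∀ h s a, ℓ h s a ∈ Set.Icc (0 : ℝ) 1) (h : Fin H) (s : S) :
    episodeMean M π (fun τ => pastCost ℓ h τ * if (τ h).1 = s then 1 else 0) ∈
      Set.Icc 0 (h * stateOcc M π h s) := by
  constructor
  · exact episodeMean_nonneg M π fun τ =>
      mul_nonneg (pastCost_mem_Icc hℓ h τ).1 (by split_ifs <;> norm_num)
  · rw [stateOcc_eq_episodeMean, ← episodeMean_const_mul]
    exact episodeMean_mono M π fun τ =>
      mul_le_mul_of_nonneg_right (pastCost_mem_Icc hℓ h τ).2 (by split_ifs <;> norm_num)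

theorem uFun_mem_Icc (M : MDP S A H) (π : Policy S A H) {ℓ : Cost S A H}
    (hℓ : ∀ h s a, ℓ h s a ∈ Set.Icc (0 : ℝ) 1) (h : Fin H) (s : S) (a : A) :
    uFun M π ℓ h s a ∈ Set.Icc (0 : ℝ) H := by
  have hq := qFun_mem_Icc M π ℓ hℓ (H - h) h (by omega) s a
  have hp := episodeMean_pastCost_mem_Icc M π hℓ h s
  have hw0 : 0 ≤ wFun M π ℓ h s := div_nonneg hp.1 (stateOcc_nonneg M π h s)
  have hw : wFun M π ℓ h s ≤ h :=
    div_le_of_le_mul₀ (stateOcc_nonneg M π h s) (Nat.cast_nonneg _) hp.2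
  have hc : ((H - h : ℕ) : ℝ) = H - (h : ℕ) := Nat.cast_sub h.isLt.le
  rw [hc, mul_one] at hq
  exact ⟨add_nonneg hq.1 hw0, by unfold uFun; linarith [hq.2]⟩

/-- The mean of the aggregate loss on the visits of `(s, a)` at step `h`. -/
theorem episodeMean_visit_mul_totalCost (M : MDP S A H) (π : Policy S A H) {ℓ : Cost S A H}
    (hℓ : ∀ h s a, ℓ h s a ∈ Set.Icc (0 : ℝ) 1) (h : Fin H) (s : S) (a : A) :
    episodeMean M π (fun τ => (if τ h = (s, a) then 1 else 0) * totalCost ℓ τ) =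
      occ M π h s a * uFun M π ℓ h s a := by
  have hfut := episodeMean_mul_futureCost M π ℓ (H - h - 1) h h.isLt (by omega)
    (dependsOn_visit h s a)
  have hq : episodeMean M π (fun τ => (if τ h = (s, a) then 1 else 0) *
      qFun M π ℓ h (τ h).1 (τ h).2) = occ M π h s a * qFun M π ℓ h s a := by
    rw [occ_eq_episodeMean, mul_comm, ← episodeMean_const_mul]
    congr 1
    funext τ
    split_ifs with hτ
    · simp [hτ]
    · simp
  have hpast := episodeMean_mul_visit M π h s a (dependsOn_pastCost ℓ h)
  have hw : episodeMean M π (fun τ => pastCost ℓ h τ * if (τ h).1 = s then 1 else 0) =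
      stateOcc M π h s * wFun M π ℓ h s := by
    by_cases h0 : stateOcc M π h s = 0
    · have hp := episodeMean_pastCost_mem_Icc M π hℓ h s
      rw [h0, mul_zero] at hp
      rw [h0, zero_mul]
      exact le_antisymm hp.2 hp.1
    · rw [wFun, mul_div_cancel₀ _ h0]
  simp only [totalCost_eq_pastCost_add ℓ h, mul_add, episodeMean_add]
  rw [hfut, hq]
  simp only [mul_comm (ite _ _ _) (pastCost _ _ _)]
  rw [hpast, hw, uFun, occ_eq_stateOcc_mul]
  ring

theorem vFun_sub_qFun_eq (M : MDP S A H) (π : Policy S A H) (c : Cost S A H) (h : Fin H) (s : S)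
    (a : A) :
    vFun M π c h s - qFun M π c h s a =
      ∑ a', π.prob h s a' * uFun M π c h s a' - uFun M π c h s a := by
  simp only [uFun, mul_add, Finset.sum_add_distrib, ← Finset.sum_mul, π.prob_sum, vFun]
  ring

end UFunction

/-! ### Exponential moments of the estimator -/

section Moments

theorem exp_le_one_add_add_sq {x : ℝ} (hx : x ≤ 1) : Real.exp x ≤ 1 + x + x ^ 2 := by
  rcases le_or_gt (-1) x with h | h
  · have := Real.abs_exp_sub_one_sub_id_le (abs_le.mpr ⟨h, hx⟩)
    linarith [(abs_le.mp this).2]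
  · have h1 : Real.exp x ≤ 1 := Real.exp_le_one_iff.mpr (by linarith)
    nlinarith

theorem exp_neg_le_one_sub_add_sq {x : ℝ} (hx : 0 ≤ x) :
    Real.exp (-x) ≤ 1 - x + x ^ 2 / 2 := by
  -- The inverse of the right side is at most `1 + x + x² / 2 ≤ exp x`.
  have h1 := Real.quadratic_le_exp_of_nonneg hx
  have h2 : 0 < 1 - x + x ^ 2 / 2 := by nlinarith [sq_nonneg (x - 1)]
  rw [Real.exp_neg, inv_le_iff_one_le_mul₀ (Real.exp_pos x)]
  calc (1 : ℝ) ≤ (1 - x + x ^ 2 / 2) * (1 + x + x ^ 2 / 2) := by nlinarith [sq_nonneg (x ^ 2)]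
    _ ≤ _ := mul_le_mul_of_nonneg_left h1 h2.le

variable {S A : Type*} {H : ℕ} [Fintype S] [Fintype A] [DecidableEq S] [DecidableEq A]
  (M : MDP S A H) (γ : ℝ) (π : Policy S A H) (ℓ : Cost S A H)

theorem uHat_eq (τ : Traj S A H) (h : Fin H) (s : S) (a : A) :
    uHat M γ π (τ, totalCost ℓ τ) h s a =
      (occ M π h s a + γ)⁻¹ * ((if τ h = (s, a) then 1 else 0) * totalCost ℓ τ) := by
  simp only [uHat]
  ring

theorem uHat_nonneg (hγ : 0 < γ) (hℓ : ∀ h s a, ℓ h s a ∈ Set.Icc (0 : ℝ) 1) (τ : Traj S A H)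
    (h : Fin H) (s : S) (a : A) : 0 ≤ uHat M γ π (τ, totalCost ℓ τ) h s a := by
  have h1 := occ_nonneg M π h s a
  have h2 := (totalCost_mem_Icc hℓ τ).1
  rw [uHat_eq]
  have : (0 : ℝ) ≤ if τ h = (s, a) then 1 else 0 := by split_ifs <;> norm_num
  positivity

/-- The estimator is bounded by its largest importance weight times the horizon. -/
theorem uHat_le (hγ : 0 < γ) (hℓ : ∀ h s a, ℓ h s a ∈ Set.Icc (0 : ℝ) 1) (τ : Traj S A H)
    (h : Fin H) (s : S) (a : A) :
    uHat M γ π (τ, totalCost ℓ τ) h s a ≤ H / (occ M π h s a + γ) := by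
  have h1 := occ_nonneg M π h s a
  have h2 := totalCost_mem_Icc hℓ τ
  rw [uHat_eq, div_eq_inv_mul]
  refine mul_le_mul_of_nonneg_left ?_ (by positivity)
  split_ifs
  · rw [one_mul]; exact h2.2
  · rw [zero_mul]; positivity

theorem episodeMean_uHat (hℓ : ∀ h s a, ℓ h s a ∈ Set.Icc (0 : ℝ) 1) (h : Fin H) (s : S) (a : A) :
    episodeMean M π (fun τ => uHat M γ π (τ, totalCost ℓ τ) h s a) =
      occ M π h s a * uFun M π ℓ h s a / (occ M π h s a + γ) := by
  simp only [uHat_eq, episodeMean_const_mul]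
  rw [episodeMean_visit_mul_totalCost M π hℓ, div_eq_inv_mul]

theorem episodeMean_uHat_sq_le (hγ : 0 < γ) (hℓ : ∀ h s a, ℓ h s a ∈ Set.Icc (0 : ℝ) 1)
    (h : Fin H) (s : S) (a : A) :
    episodeMean M π (fun τ => uHat M γ π (τ, totalCost ℓ τ) h s a ^ 2) ≤
      H ^ 2 / (occ M π h s a + γ) := by
  have h1 := occ_nonneg M π h s a
  have hp : 0 < occ M π h s a + γ := by positivity
  have hU := uFun_mem_Icc M π hℓ h s a
  calc _ ≤ episodeMean M π (fun τ => H / (occ M π h s a + γ) *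
          uHat M γ π (τ, totalCost ℓ τ) h s a) := episodeMean_mono M π fun τ => by
        rw [sq]
        exact mul_le_mul_of_nonneg_right (uHat_le M γ π ℓ hγ hℓ τ h s a)
          (uHat_nonneg M γ π ℓ hγ hℓ τ h s a)
    _ = H / (occ M π h s a + γ) * (occ M π h s a / (occ M π h s a + γ) * uFun M π ℓ h s a) := by
        rw [episodeMean_const_mul, episodeMean_uHat M γ π ℓ hℓ]
        ring
    _ ≤ H / (occ M π h s a + γ) * (1 * H) := by
        refine mul_le_mul_of_nonneg_left ?_ (by positivity)
        refine mul_le_mul ?_ hU.2 hU.1 zero_le_one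
        rw [div_le_one hp]
        linarith
    _ = _ := by ring

/-- The implicit exploration parameter `γ` makes the estimator optimistic: its upper deviations
have an exponential moment at most one at scale `γ / H`. -/
theorem episodeMean_exp_uHat_sub_le_one (hH : 0 < H) (hγ : 0 < γ)
    (hℓ : ∀ h s a, ℓ h s a ∈ Set.Icc (0 : ℝ) 1) (h : Fin H) (s : S) (a : A) :
    episodeMean M π (fun τ => Real.exp (γ / H *
      (uHat M γ π (τ, totalCost ℓ τ) h s a - uFun M π ℓ h s a))) ≤ 1 := by
  have h1 := occ_nonneg M π h s a
  have hU := uFun_mem_Icc M π hℓ h s a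
  have hH' : (0 : ℝ) < H := by exact_mod_cast hH
  set μ := occ M π h s a with hμ
  set U := uFun M π ℓ h s a with hUdef
  have hp : 0 < μ + γ := by positivity
  have hpt : ∀ τ : Traj S A H, Real.exp (γ / H * uHat M γ π (τ, totalCost ℓ τ) h s a) ≤
      1 + (γ / H * (1 + γ / (μ + γ))) * uHat M γ π (τ, totalCost ℓ τ) h s a := by
    intro τ
    have hx0 := uHat_nonneg M γ π ℓ hγ hℓ τ h s a
    have hx1 := uHat_le M γ π ℓ hγ hℓ τ h s a
    set x := uHat M γ π (τ, totalCost ℓ τ) h s a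
    have hy0 : 0 ≤ γ / H * x := by positivity
    have hy1 : γ / H * x ≤ γ / (μ + γ) :=
      calc γ / H * x ≤ γ / H * (H / (μ + γ)) := mul_le_mul_of_nonneg_left hx1 (by positivity)
        _ = γ / (μ + γ) := by field_simp
    have hy2 : γ / (μ + γ) ≤ 1 := by rw [div_le_one hp]; linarith
    have := exp_le_one_add_add_sq (hy1.trans hy2)
    nlinarith [mul_le_mul_of_nonneg_left hy1 hy0]
  have hmean : episodeMean M π (fun τ => Real.exp (γ / H * uHat M γ π (τ, totalCost ℓ τ) h s a))
      ≤ Real.exp (γ / H * U) := by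
    refine (episodeMean_mono M π hpt).trans ?_
    rw [episodeMean_add, episodeMean_const, episodeMean_const_mul, episodeMean_uHat M γ π ℓ hℓ]
    have hfac : (1 + γ / (μ + γ)) * (μ / (μ + γ)) ≤ 1 := by
      rw [one_add_div hp.ne', div_mul_div_comm, div_le_one (by positivity)]
      nlinarith
    have : γ / H * (1 + γ / (μ + γ)) * (μ * U / (μ + γ)) ≤ γ / H * U := by
      calc _ = γ / H * U * ((1 + γ / (μ + γ)) * (μ / (μ + γ))) := by ring
        _ ≤ γ / H * U * 1 := mul_le_mul_of_nonneg_left hfac (mul_nonneg (by positivity) hU.1)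
        _ = _ := mul_one _
    linarith [Real.add_one_le_exp (γ / H * U)]
  have hsplit : ∀ x : ℝ, Real.exp (γ / H * (x - U)) =
      Real.exp (-(γ / H * U)) * Real.exp (γ / H * x) := fun x => by
    rw [← Real.exp_add]; congr 1; ring
  simp only [hsplit]
  rw [episodeMean_const_mul]
  calc _ ≤ Real.exp (-(γ / H * U)) * Real.exp (γ / H * U) :=
        mul_le_mul_of_nonneg_left hmean (Real.exp_pos _).le
    _ = 1 := by rw [← Real.exp_add]; simp

theorem bonusLoss_eq (h : Fin H) (s : S) :
    bonusLoss M γ π h s = 3 * γ * H * ∑ a, π.prob h s a / (occ M π h s a + γ) := by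
  simp only [bonusLoss, Finset.mul_sum, occ_eq_stateOcc_mul]
  exact Finset.sum_congr rfl fun a _ => by ring

/-- The lower deviations of the averaged estimator, together with the second order term of
the multiplicative weights analysis, are paid for by two thirds of the bonus loss. -/
theorem episodeMean_exp_average_le_one {η : ℝ} (hη : 0 < η) (hH : 0 < H) (hγ : γ = 2 * η * H)
    (hℓ : ∀ h s a, ℓ h s a ∈ Set.Icc (0 : ℝ) 1) (h : Fin H) (s : S) :
    episodeMean M π (fun τ => Real.exp (γ / H *
      (∑ a, π.prob h s a * uFun M π ℓ h s a
        - ∑ a, π.prob h s a * uHat M γ π (τ, totalCost ℓ τ) h s a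
        + η * ∑ a, π.prob h s a * uHat M γ π (τ, totalCost ℓ τ) h s a ^ 2
        - 2 / 3 * bonusLoss M γ π h s))) ≤ 1 := by
  have hH' : (0 : ℝ) < H := by exact_mod_cast hH
  have hγ0 : 0 < γ := by rw [hγ]; positivity
  have hscale : γ / H = 2 * η := by rw [hγ]; field_simp
  have hπ := fun a => π.prob_nonneg h s a
  set X : Traj S A H → ℝ := fun τ => ∑ a, π.prob h s a * uHat M γ π (τ, totalCost ℓ τ) h s a
    with hX
  set Z : Traj S A H → ℝ := fun τ => ∑ a, π.prob h s a * uHat M γ π (τ, totalCost ℓ τ) h s a ^ 2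
    with hZ
  set m := ∑ a, π.prob h s a * uFun M π ℓ h s a with hm
  set b := bonusLoss M γ π h s with hb
  have hu0 : ∀ τ a, 0 ≤ uHat M γ π (τ, totalCost ℓ τ) h s a := fun τ a =>
    uHat_nonneg M γ π ℓ hγ0 hℓ τ h s a
  have hZX : ∀ τ, η * Z τ ≤ X τ := by
    intro τ
    simp only [hX, hZ, Finset.mul_sum]
    refine Finset.sum_le_sum fun a _ => ?_
    have h1 : η * uHat M γ π (τ, totalCost ℓ τ) h s a ≤ 1 := by
      have h2 := uHat_le M γ π ℓ hγ0 hℓ τ h s a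
      have h3 := occ_nonneg M π h s a
      calc _ ≤ η * (H / (occ M π h s a + γ)) := mul_le_mul_of_nonneg_left h2 hη.le
        _ ≤ 1 := by
          rw [← mul_div_assoc, div_le_one (by positivity), hγ]
          nlinarith [mul_pos hη hH']
    calc _ = π.prob h s a * uHat M γ π (τ, totalCost ℓ τ) h s a *
          (η * uHat M γ π (τ, totalCost ℓ τ) h s a) := by ring
      _ ≤ π.prob h s a * uHat M γ π (τ, totalCost ℓ τ) h s a * 1 :=
          mul_le_mul_of_nonneg_left h1 (mul_nonneg (hπ a) (hu0 τ a))
      _ = _ := mul_one _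
  have hZ0 : ∀ τ, 0 ≤ Z τ := fun τ => Finset.sum_nonneg fun a _ => mul_nonneg (hπ a) (sq_nonneg _)
  have hX2 : ∀ τ, X τ ^ 2 ≤ Z τ := fun τ =>
    Real.pow_arith_mean_le_arith_mean_pow Finset.univ _ _ (fun a _ => hπ a)
      (π.prob_sum h s) (fun a _ => hu0 τ a) 2
  have hpt : ∀ τ, Real.exp (2 * η * (-X τ + η * Z τ)) ≤ 1 + (-(2 * η) * X τ + 4 * η ^ 2 * Z τ) := by
    intro τ
    have hy : 0 ≤ 2 * η * (X τ - η * Z τ) := mul_nonneg (by positivity) (by linarith [hZX τ])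
    have h1 := exp_neg_le_one_sub_add_sq hy
    have h2 : (2 * η * (X τ - η * Z τ)) ^ 2 ≤ 4 * η ^ 2 * Z τ := by
      have h3 : (X τ - η * Z τ) ^ 2 ≤ X τ ^ 2 :=
        pow_le_pow_left₀ (by linarith [hZX τ]) (by nlinarith [hZ0 τ]) 2
      calc _ = 4 * η ^ 2 * (X τ - η * Z τ) ^ 2 := by ring
        _ ≤ 4 * η ^ 2 * Z τ :=
            mul_le_mul_of_nonneg_left (h3.trans (hX2 τ)) (by positivity)
    rw [show 2 * η * (-X τ + η * Z τ) = -(2 * η * (X τ - η * Z τ)) by ring]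
    nlinarith
  have hEX : m - b / 3 ≤ episodeMean M π X := by
    have h1 : episodeMean M π X = ∑ a, π.prob h s a *
        (occ M π h s a * uFun M π ℓ h s a / (occ M π h s a + γ)) := by
      rw [hX, episodeMean_sum M π Finset.univ]
      simp only [episodeMean_const_mul, episodeMean_uHat M γ π ℓ hℓ]
    rw [h1, hb, bonusLoss_eq, hm, sub_le_iff_le_add]
    calc _ ≤ ∑ a, (π.prob h s a * (occ M π h s a * uFun M π ℓ h s a / (occ M π h s a + γ)) +
          γ * H * (π.prob h s a / (occ M π h s a + γ))) := by
          refine Finset.sum_le_sum fun a _ => ?_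
          have hU := uFun_mem_Icc M π hℓ h s a
          have hp : 0 < occ M π h s a + γ := add_pos_of_nonneg_of_pos (occ_nonneg M π h s a) hγ0
          rw [show π.prob h s a * uFun M π ℓ h s a = (π.prob h s a * (occ M π h s a *
            uFun M π ℓ h s a / (occ M π h s a + γ)) + γ * uFun M π ℓ h s a *
              (π.prob h s a / (occ M π h s a + γ))) by field_simp]
          have : 0 ≤ π.prob h s a / (occ M π h s a + γ) := div_nonneg (hπ a) hp.le
          have := mul_le_mul_of_nonneg_right (mul_le_mul_of_nonneg_left hU.2 hγ0.le) this
          linarith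
      _ = _ := by rw [Finset.sum_add_distrib, ← Finset.mul_sum]; ring
  have hEZ : 2 * η * episodeMean M π Z ≤ b / 3 := by
    have h1 : episodeMean M π Z ≤ H ^ 2 * ∑ a, π.prob h s a / (occ M π h s a + γ) := by
      rw [hZ, episodeMean_sum M π Finset.univ, Finset.mul_sum]
      refine Finset.sum_le_sum fun a _ => ?_
      rw [episodeMean_const_mul]
      calc _ ≤ π.prob h s a * (H ^ 2 / (occ M π h s a + γ)) :=
            mul_le_mul_of_nonneg_left (episodeMean_uHat_sq_le M γ π ℓ hγ0 hℓ h s a) (hπ a)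
        _ = _ := by ring
    rw [hb, bonusLoss_eq]
    calc _ ≤ 2 * η * (H ^ 2 * ∑ a, π.prob h s a / (occ M π h s a + γ)) :=
          mul_le_mul_of_nonneg_left h1 (by positivity)
      _ = _ := by
        rw [show 2 * η * ((H : ℝ) ^ 2 * ∑ a, π.prob h s a / (occ M π h s a + γ)) =
          (2 * η * H) * H * ∑ a, π.prob h s a / (occ M π h s a + γ) by ring, ← hγ]
        ring
  have hmean : episodeMean M π (fun τ => Real.exp (2 * η * (-X τ + η * Z τ))) ≤
      Real.exp (2 * η * (-m + 2 / 3 * b)) := by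
    refine (episodeMean_mono M π hpt).trans ?_
    rw [episodeMean_add, episodeMean_const, episodeMean_add, episodeMean_const_mul,
      episodeMean_const_mul]
    have := Real.add_one_le_exp (2 * η * (-m + 2 / 3 * b))
    nlinarith [mul_le_mul_of_nonneg_left hEX hη.le, mul_le_mul_of_nonneg_left hEZ hη.le]
  have hsplit : ∀ τ, Real.exp (γ / H * (m - X τ + η * Z τ - 2 / 3 * b)) =
      Real.exp (-(2 * η * (-m + 2 / 3 * b))) * Real.exp (2 * η * (-X τ + η * Z τ)) := fun τ => by
    rw [← Real.exp_add, hscale]; congr 1; ring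
  change episodeMean M π (fun τ => Real.exp (γ / H * (m - X τ + η * Z τ - 2 / 3 * b))) ≤ 1
  simp only [hsplit]
  rw [episodeMean_const_mul]
  calc _ ≤ Real.exp (-(2 * η * (-m + 2 / 3 * b))) * Real.exp (2 * η * (-m + 2 / 3 * b)) :=
        mul_le_mul_of_nonneg_left hmean (Real.exp_pos _).le
    _ = 1 := by rw [← Real.exp_add]; simp

end Moments

/-! ### The size of the bonus -/

section Bonus

variable {S A : Type*} {H : ℕ} [Fintype S] [Fintype A] [DecidableEq S] [DecidableEq A]
  (M : MDP S A H) (γ : ℝ) (π : Policy S A H)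

/-- The bonus is the `Q`-function of the bonus losses. -/
theorem bonus_eq_qFun (h : ℕ) (s : S) (a : A) :
    bonus M γ π h s a = qFun M π (fun i s _ => bonusLoss M γ π i s) h s a := by
  induction hn : H - h generalizing h s a with
  | zero => rw [bonus, qFun, dif_neg (by omega), dif_neg (by omega)]
  | succ n ih =>
    rw [bonus, qFun]
    simp only [fun s a => ih (h + 1) s a (by omega)]

theorem bonusLoss_mem_Icc (hγ : 0 < γ) (h : Fin H) (s : S) :
    bonusLoss M γ π h s ∈ Set.Icc (0 : ℝ) (3 * H) := by
  have hp : ∀ a, 0 < occ M π h s a + γ := fun a =>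
    add_pos_of_nonneg_of_pos (occ_nonneg M π h s a) hγ
  rw [bonusLoss_eq]
  constructor
  · exact mul_nonneg (by positivity)
      (Finset.sum_nonneg fun a _ => div_nonneg (π.prob_nonneg h s a) (hp a).le)
  · calc _ ≤ 3 * γ * H * ∑ a, π.prob h s a / γ := by
          refine mul_le_mul_of_nonneg_left (Finset.sum_le_sum fun a _ => ?_) (by positivity)
          exact div_le_div_of_nonneg_left (π.prob_nonneg h s a) hγ
            (by linarith [occ_nonneg M π h s a])
      _ = 3 * H := by
          rw [← Finset.sum_div, π.prob_sum]
          field_simp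

theorem bonus_mem_Icc (hγ : 0 < γ) (h : Fin H) (s : S) (a : A) :
    bonus M γ π h s a ∈ Set.Icc (0 : ℝ) (3 * H ^ 2) := by
  rw [bonus_eq_qFun]
  have := qFun_mem_Icc M π (fun i s _ => bonusLoss M γ π i s)
    (fun i s _ => bonusLoss_mem_Icc M γ π hγ i s) (H - h) h (by omega) s a
  refine ⟨this.1, this.2.trans ?_⟩
  have h1 : ((H - h : ℕ) : ℝ) ≤ H := by exact_mod_cast Nat.sub_le H h
  nlinarith [Nat.cast_nonneg (α := ℝ) H]

/-- The bonus losses are small under the policy's own occupancy measure. -/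
theorem value_bonusLoss_le (hγ : 0 < γ) :
    value M π (fun h s _ => bonusLoss M γ π h s) ≤
      3 * γ * H ^ 2 * (Fintype.card S * Fintype.card A) := by
  have hh : ∀ h : Fin H, episodeMean M π (fun τ => bonusLoss M γ π h (τ h).1) ≤
      3 * γ * H * (Fintype.card S * Fintype.card A) := by
    intro h
    rw [episodeMean_eq_sum_occ M π h fun s _ => bonusLoss M γ π h s]
    have hs : ∀ s, ∑ a, occ M π h s a * bonusLoss M γ π h s ≤ 3 * γ * H * Fintype.card A := by
      intro s
      rw [← Finset.sum_mul, bonusLoss_eq, mul_left_comm, Finset.mul_sum]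
      refine mul_le_mul_of_nonneg_left ?_ (by positivity)
      calc _ ≤ ∑ _a : A, (1 : ℝ) := Finset.sum_le_sum fun a _ => by
            have h1 := occ_nonneg M π h s a
            change stateOcc M π h s * _ ≤ 1
            rw [← mul_div_assoc, ← occ_eq_stateOcc_mul, div_le_one (by positivity)]
            linarith
        _ = _ := by simp
    calc _ ≤ ∑ _s : S, 3 * γ * H * Fintype.card A := Finset.sum_le_sum fun s _ => hs s
      _ = _ := by rw [Finset.sum_const, Finset.card_univ, nsmul_eq_mul]; ring
  have hsum : value M π (fun h s _ => bonusLoss M γ π h s) =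
      ∑ h, episodeMean M π (fun τ => bonusLoss M γ π h (τ h).1) :=
    episodeMean_sum M π Finset.univ fun h τ => bonusLoss M γ π h (τ h).1
  rw [hsum]
  calc _ ≤ ∑ _h : Fin H, 3 * γ * H * (Fintype.card S * Fintype.card A : ℝ) :=
        Finset.sum_le_sum fun h _ => hh h
    _ = _ := by rw [Finset.sum_const, Finset.card_univ, nsmul_eq_mul, Fintype.card_fin]; ring

end Bonus

/-! ### Multiplicative weights -/

section MultiplicativeWeights

variable {A : Type*} [Fintype A]

/-- The regret of multiplicative weights against a fixed action, for losses bounded below. -/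
theorem multiplicativeWeights_regret {η : ℝ} (hη : 0 < η) (w g : ℕ → A → ℝ)
    (hw0 : ∀ a, w 0 a = 1 / (Fintype.card A : ℝ)) (hpos : ∀ k a, 0 < w k a)
    (hsum : ∀ k, ∑ a, w k a = 1) (K : ℕ)
    (hg : ∀ k < K, ∀ a, -η * g k a ≤ 1)
    (hw : ∀ k < K, ∀ a, w (k + 1) a =
      w k a * Real.exp (-η * g k a) / ∑ a', w k a' * Real.exp (-η * g k a')) (a : A) :
    ∑ k ∈ Finset.range K, (∑ a', w k a' * g k a' - g k a) ≤
      Real.log (Fintype.card A) / η + η * ∑ k ∈ Finset.range K, ∑ a', w k a' * g k a' ^ 2 := by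
  have hstep : ∀ k ∈ Finset.range K, η * (∑ a', w k a' * g k a' - g k a) -
      η ^ 2 * ∑ a', w k a' * g k a' ^ 2 ≤ Real.log (w (k + 1) a) - Real.log (w k a) := by
    intro k hk
    rw [Finset.mem_range] at hk
    have hZ : 0 < ∑ a', w k a' * Real.exp (-η * g k a') :=
      Finset.sum_pos (fun a' _ => mul_pos (hpos k a') (Real.exp_pos _)) ⟨a, Finset.mem_univ a⟩
    have hZle : ∑ a', w k a' * Real.exp (-η * g k a') ≤
        1 + (-η * ∑ a', w k a' * g k a' + η ^ 2 * ∑ a', w k a' * g k a' ^ 2) := by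
      calc _ ≤ ∑ a', (w k a' + (-η * (w k a' * g k a') + η ^ 2 * (w k a' * g k a' ^ 2))) := by
            refine Finset.sum_le_sum fun a' _ => ?_
            have := mul_le_mul_of_nonneg_left (exp_le_one_add_add_sq (hg k hk a')) (hpos k a').le
            linarith
        _ = _ := by
            rw [Finset.sum_add_distrib, Finset.sum_add_distrib, hsum, Finset.mul_sum,
              Finset.mul_sum]
    have hlogZ := Real.log_le_sub_one_of_pos hZ
    rw [hw k hk, Real.log_div (mul_pos (hpos k a) (Real.exp_pos _)).ne' hZ.ne',
      Real.log_mul (hpos k a).ne' (Real.exp_pos _).ne', Real.log_exp]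
    linarith
  have htel := Finset.sum_le_sum hstep
  rw [Finset.sum_range_sub (fun k => Real.log (w k a)), Finset.sum_sub_distrib, ← Finset.mul_sum,
    ← Finset.mul_sum, hw0, one_div, Real.log_inv] at htel
  have hK : Real.log (w K a) ≤ 0 := Real.log_nonpos (hpos K a).le (by
    rw [← hsum K]
    exact Finset.single_le_sum (fun a' _ => (hpos K a').le) (Finset.mem_univ a))
  refine le_of_mul_le_mul_left ?_ hη
  rw [mul_add, mul_div_cancel₀ _ hη.ne']
  linarith

end MultiplicativeWeights

/-! ### High probability events over a run -/

section Observations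

variable {S A : Type*} {H : ℕ} [Fintype S] [Nonempty A] {K : ℕ} (M : MDP S A H)
  (ℓ : Fin K → Cost S A H)

/-- The observations of a run, continued arbitrarily after its last episode. -/
def runObs (ω : Fin K → Traj S A H) (i : ℕ) : Observation S A H :=
  if hi : i < K then (ω ⟨i, hi⟩, totalCost (ℓ ⟨i, hi⟩) (ω ⟨i, hi⟩))
  else (fun _ => (M.init, Classical.arbitrary A), 0)

theorem runObs_coe (ω : Fin K → Traj S A H) (k : Fin K) :
    runObs M ℓ ω k = (ω k, totalCost (ℓ k) (ω k)) := dif_pos k.isLt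

end Observations

section Runs

variable {S A : Type*} {H : ℕ} [Fintype S] [Fintype A] [DecidableEq S] [DecidableEq A]
  [Nonempty A] {K : ℕ} (M : MDP S A H) (η γ : ℝ) (ℓ : Fin K → Cost S A H)

/-- If the increments `Y k` have exponential moment at most one whatever policy is played, then so
has their sum over a run. -/
theorem sum_runProb_mul_exp_le_one (Y : Fin K → Policy S A H → Traj S A H → ℝ)
    (hY : ∀ k π, episodeMean M π (fun τ => Real.exp (Y k π τ)) ≤ 1) :
    ∑ ω, runProb M η γ ℓ ω * Real.exp (∑ k, Y k (runPolicy M η γ ℓ ω k) (ω k)) ≤ 1 := by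
  simp only [Real.exp_sum, runProb, ← Finset.prod_mul_distrib]
  exact sum_prod_sequential_le_one K
    (fun k past τ => trajProb M (playedPolicy M η γ ℓ k past) τ *
      Real.exp (Y k (playedPolicy M η γ ℓ k past) τ))
    (fun k past τ => mul_nonneg (trajProb_nonneg M _ _) (Real.exp_pos _).le)
    (fun k past => hY k _)

/-- Markov's inequality and a union bound for finitely many exponential supermartingales. -/
theorem one_sub_le_sum_runProb {ι : Type*} [Fintype ι] [Nonempty ι]
    (Y : ι → Fin K → Policy S A H → Traj S A H → ℝ)
    (hY : ∀ i k π, episodeMean M π (fun τ => Real.exp (Y i k π τ)) ≤ 1) {δ : ℝ} (hδ : 0 < δ)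
    (p : (Fin K → Traj S A H) → Prop) [DecidablePred p]
    (hp : ∀ ω, (∀ i, ∑ k, Y i k (runPolicy M η γ ℓ ω k) (ω k) ≤
      Real.log (Fintype.card ι / δ)) → p ω) :
    1 - δ ≤ ∑ ω, if p ω then runProb M η γ ℓ ω else 0 := by
  have hN : (0 : ℝ) < Fintype.card ι := by exact_mod_cast Fintype.card_pos
  set E : ι → (Fin K → Traj S A H) → ℝ := fun i ω =>
    Real.exp (∑ k, Y i k (runPolicy M η γ ℓ ω k) (ω k)) with hE
  have hbad : ∀ ω, runProb M η γ ℓ ω - (if p ω then runProb M η γ ℓ ω else 0) ≤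
      δ / Fintype.card ι * ∑ i, runProb M η γ ℓ ω * E i ω := by
    intro ω
    have h0 := runProb_nonneg M η γ ℓ ω
    have hpos : ∀ i, 0 ≤ runProb M η γ ℓ ω * E i ω := fun i => mul_nonneg h0 (Real.exp_pos _).le
    split_ifs with hω
    · rw [sub_self]
      exact mul_nonneg (by positivity) (Finset.sum_nonneg fun i _ => hpos i)
    · have : ∃ i, Real.log (Fintype.card ι / δ) <
          ∑ k, Y i k (runPolicy M η γ ℓ ω k) (ω k) := by
        by_contra! hc
        exact hω (hp ω hc)
      obtain ⟨i, hi⟩ := this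
      have hEi : Fintype.card ι / δ ≤ E i ω := by
        rw [← Real.exp_log (show 0 < Fintype.card ι / δ by positivity)]
        exact Real.exp_le_exp.mpr hi.le
      calc runProb M η γ ℓ ω - 0
          = δ / Fintype.card ι * (runProb M η γ ℓ ω * (Fintype.card ι / δ)) := by
            field_simp; ring
        _ ≤ δ / Fintype.card ι * (runProb M η γ ℓ ω * E i ω) := by gcongr
        _ ≤ _ := by
            refine mul_le_mul_of_nonneg_left ?_ (by positivity)
            exact Finset.single_le_sum (f := fun i => runProb M η γ ℓ ω * E i ω)
              (fun i _ => hpos i) (Finset.mem_univ i)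
  have hsum := Finset.sum_le_sum fun ω (_ : ω ∈ Finset.univ) => hbad ω
  rw [Finset.sum_sub_distrib, sum_runProb, ← Finset.mul_sum, Finset.sum_comm] at hsum
  have hle : ∑ i, ∑ ω, runProb M η γ ℓ ω * E i ω ≤ Fintype.card ι := by
    calc _ ≤ ∑ _i : ι, (1 : ℝ) := Finset.sum_le_sum fun i _ =>
          sum_runProb_mul_exp_le_one M η γ ℓ (Y i) (hY i)
      _ = _ := by simp
  have : δ / Fintype.card ι * ∑ i, ∑ ω, runProb M η γ ℓ ω * E i ω ≤ δ := by
    calc _ ≤ δ / Fintype.card ι * Fintype.card ι := by gcongr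
      _ = δ := by field_simp
  linarith

open Classical in
theorem runMeasure_apply (s : Set (Fin K → Traj S A H)) :
    runMeasure M η γ ℓ s = ENNReal.ofReal (∑ ω, if ω ∈ s then runProb M η γ ℓ ω else 0) := by
  let _ : MeasurableSpace (Fin K → Traj S A H) := ⊤
  rw [runMeasure, PMF.toMeasure_apply_fintype,
    ENNReal.ofReal_sum_of_nonneg fun ω _ => by
      split_ifs
      exacts [runProb_nonneg M η γ ℓ ω, le_rfl]]
  refine Finset.sum_congr rfl fun ω _ => ?_
  rw [Set.indicator_apply, apply_ite ENNReal.ofReal, ENNReal.ofReal_zero]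
  rfl

/-! ### Multiplicative weights along a run -/

theorem runPolicy_eq_algPolicy (ω : Fin K → Traj S A H) (k : Fin K) :
    runPolicy M η γ ℓ ω k = algPolicy M η γ k fun i => runObs M ℓ ω i := by
  unfold runPolicy playedPolicy
  congr 1
  funext i
  exact (runObs_coe M ℓ ω (Fin.castLE k.isLt.le i)).symm

theorem algPolicy_prob_pos : ∀ (k : ℕ) (o : Fin k → Observation S A H) (h : Fin H) (s : S) (a : A),
    0 < (algPolicy M η γ k o).prob h s a
  | 0, _, _, _, _ => by
    simp only [algPolicy, uniformPolicy]
    positivity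
  | k + 1, o, h, s, a => by
    simp only [algPolicy, mwUpdate]
    exact div_pos (mul_pos (algPolicy_prob_pos k _ h s a) (Real.exp_pos _))
      (sum_mwWeight_pos M η γ _ _ h s)

/-- The multiplicative weights bound for the losses `uHat - bonus` of a run. -/
theorem run_multiplicativeWeights (hη : 0 < η) (hγ : 0 < γ) (hηH : η * (3 * H ^ 2) ≤ 1)
    (hℓ : ∀ k h s a, ℓ k h s a ∈ Set.Icc (0 : ℝ) 1) (ω : Fin K → Traj S A H)
    (π : Fin K → Policy S A H) (hπ : ∀ k, π k = runPolicy M η γ ℓ ω k)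
    (u : Fin K → A → ℝ) (h : Fin H) (s : S)
    (hu : ∀ k a, u k a = uHat M γ (π k) (ω k, totalCost (ℓ k) (ω k)) h s a) (a : A) :
    ∑ k, (∑ a', (π k).prob h s a' * (u k a' - bonus M γ (π k) h s a') -
        (u k a - bonus M γ (π k) h s a)) ≤
      Real.log (Fintype.card A) / η + η * ∑ k, ∑ a', (π k).prob h s a' * u k a' ^ 2 +
        9 * η * H ^ 4 * K := by
  set P : ℕ → Policy S A H := fun k => algPolicy M η γ k fun i => runObs M ℓ ω i with hP
  have hPπ : ∀ k : Fin K, π k = P k := fun k => by rw [hπ, runPolicy_eq_algPolicy]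
  set g : ℕ → A → ℝ := fun k a =>
    uHat M γ (P k) (runObs M ℓ ω k) h s a - bonus M γ (P k) h s a with hg
  have hgk : ∀ (k : Fin K) a, g k a = u k a - bonus M γ (π k) h s a := fun k a => by
    rw [hu, hPπ, ← runObs_coe M ℓ]
  have hu0 : ∀ k a, 0 ≤ u k a := fun k a => by
    rw [hu]
    exact uHat_nonneg M γ (π k) (ℓ k) hγ (hℓ k) (ω k) h s a
  have hB := fun k a => bonus_mem_Icc M γ (π k) hγ h s a
  have key := multiplicativeWeights_regret hη (fun k a => (P k).prob h s a) g
    (fun a => rfl) (fun k a => algPolicy_prob_pos M η γ k _ h s a)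
    (fun k => (P k).prob_sum h s) K
    (fun k hk a => by
      rw [hgk ⟨k, hk⟩]
      have h1 := hu0 ⟨k, hk⟩ a
      have h2 := (hB ⟨k, hk⟩ a).2
      nlinarith [mul_le_mul_of_nonneg_left h2 hη.le, mul_nonneg hη.le h1])
    (fun k hk a => rfl) a
  rw [← Fin.sum_univ_eq_sum_range
      (fun k => ∑ a', (P k).prob h s a' * g k a' - g k a) K,
    ← Fin.sum_univ_eq_sum_range (fun k => ∑ a', (P k).prob h s a' * g k a' ^ 2) K] at key
  simp only [hgk, ← hPπ] at key
  refine key.trans ?_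
  rw [add_assoc]
  refine add_le_add_right ?_ _
  have hsq : ∀ k, ∑ a', (π k).prob h s a' * (u k a' - bonus M γ (π k) h s a') ^ 2 ≤
      ∑ a', (π k).prob h s a' * u k a' ^ 2 + 9 * H ^ 4 := by
    intro k
    calc _ ≤ ∑ a', ((π k).prob h s a' * u k a' ^ 2 + (π k).prob h s a' * (9 * H ^ 4)) := by
          refine Finset.sum_le_sum fun a' _ => ?_
          rw [← mul_add]
          refine mul_le_mul_of_nonneg_left ?_ ((π k).prob_nonneg h s a')
          have h1 := hu0 k a'
          have h2 := hB k a'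
          have h3 : bonus M γ (π k) h s a' ^ 2 ≤ (3 * H ^ 2) ^ 2 := pow_le_pow_left₀ h2.1 h2.2 2
          nlinarith [mul_nonneg h1 h2.1]
      _ = _ := by rw [Finset.sum_add_distrib, ← Finset.sum_mul, (π k).prob_sum, one_mul]
  have := mul_le_mul_of_nonneg_left (Finset.sum_le_sum fun k (_ : k ∈ Finset.univ) => hsq k) hη.le
  rw [Finset.sum_add_distrib, Finset.sum_const, Finset.card_univ, Fintype.card_fin,
    nsmul_eq_mul] at this
  linarith

/-! ### Regret on the good event -/

/-- The concentrated increments: for each `(h, s)` the lower deviation of the averaged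
estimator, for each `(h, s, a)` the upper deviation of the estimator. -/
def deviation : (Fin H × S) ⊕ (Fin H × S × A) → Fin K → Policy S A H → Traj S A H → ℝ
  | Sum.inl (h, s), k, π, τ => γ / H *
      (∑ a, π.prob h s a * uFun M π (ℓ k) h s a
        - ∑ a, π.prob h s a * uHat M γ π (τ, totalCost (ℓ k) τ) h s a
        + η * ∑ a, π.prob h s a * uHat M γ π (τ, totalCost (ℓ k) τ) h s a ^ 2
        - 2 / 3 * bonusLoss M γ π h s)
  | Sum.inr (h, s, a), k, π, τ => γ / H *
      (uHat M γ π (τ, totalCost (ℓ k) τ) h s a - uFun M π (ℓ k) h s a)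

/-- On the good event, where the deviations sum to at most `Λ` along the run, the sum of the
advantages at `(h, s, a)`, for the costs less the bonus
losses, is at most a constant plus the bonus losses at `(h, s)`. -/
theorem sum_advantage_le (hη : 0 < η) (hH : 0 < H) (hγ : γ = 2 * η * H)
    (hηH : η * (3 * H ^ 2) ≤ 1) (hℓ : ∀ k h s a, ℓ k h s a ∈ Set.Icc (0 : ℝ) 1)
    (ω : Fin K → Traj S A H) (π : Fin K → Policy S A H)
    (hπ : ∀ k, π k = runPolicy M η γ ℓ ω k) {Λ : ℝ}
    (hω : ∀ i, ∑ k, deviation M η γ ℓ i k (π k) (ω k) ≤ Λ) (h : Fin H) (s : S) (a : A) :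
    ∑ k, ((vFun M (π k) (ℓ k) h s - qFun M (π k) (ℓ k) h s a) -
        (vFun M (π k) (fun h s _ => bonusLoss M γ (π k) h s) h s -
          qFun M (π k) (fun h s _ => bonusLoss M γ (π k) h s) h s a)) ≤
      Λ / η + Real.log (Fintype.card A) / η + 9 * η * H ^ 4 * K +
        ∑ k, bonusLoss M γ (π k) h s := by
  have hH' : (0 : ℝ) < H := by exact_mod_cast hH
  have hγ0 : 0 < γ := by rw [hγ]; positivity
  have hscale : γ / H = 2 * η := by rw [hγ]; field_simp
  have hb : 0 ≤ ∑ k, bonusLoss M γ (π k) h s :=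
    Finset.sum_nonneg fun k _ => (bonusLoss_mem_Icc M γ (π k) hγ0 h s).1
  have hmw := run_multiplicativeWeights M η γ ℓ hη hγ0 hηH hℓ ω π hπ
    (fun k a => uHat M γ (π k) (ω k, totalCost (ℓ k) (ω k)) h s a) h s (fun _ _ => rfl) a
  have h1 := hω (Sum.inl (h, s))
  have h2 := hω (Sum.inr (h, s, a))
  simp only [deviation, hscale, ← Finset.mul_sum] at h1 h2
  have hdiv : ∀ x : ℝ, 2 * η * x ≤ Λ → x ≤ Λ / η / 2 := fun x hx => by
    rw [div_div, le_div_iff₀ (by positivity)]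
    linarith
  have h1' := hdiv _ h1
  have h2' := hdiv _ h2
  simp only [vFun_sub_qFun_eq M (π _) (ℓ _)]
  simp only [vFun, ← bonus_eq_qFun]
  simp only [mul_sub, Finset.sum_sub_distrib, Finset.sum_add_distrib, ← Finset.mul_sum]
    at hmw h1' h2' ⊢
  linarith

/-- On the good event, the regret against any policy is bounded. -/
theorem sum_value_sub_value_le (hη : 0 < η) (hH : 0 < H) (hγ : γ = 2 * η * H)
    (hηH : η * (3 * H ^ 2) ≤ 1) (hℓ : ∀ k h s a, ℓ k h s a ∈ Set.Icc (0 : ℝ) 1)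
    (ω : Fin K → Traj S A H) (π : Fin K → Policy S A H)
    (hπ : ∀ k, π k = runPolicy M η γ ℓ ω k) {Λ : ℝ}
    (hω : ∀ i, ∑ k, deviation M η γ ℓ i k (π k) (ω k) ≤ Λ) (π' : Policy S A H) :
    ∑ k, value M (π k) (ℓ k) - ∑ k, value M π' (ℓ k) ≤
      H * (Λ / η + Real.log (Fintype.card A) / η + 9 * η * H ^ 4 * K) +
        K * (3 * γ * H ^ 2 * (Fintype.card S * Fintype.card A)) := by
  have hγ0 : 0 < γ := by
    have : (0 : ℝ) < H := by exact_mod_cast hH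
    rw [hγ]; positivity
  set b : Fin K → Cost S A H := fun k h s _ => bonusLoss M γ (π k) h s with hb
  set D := Λ / η + Real.log (Fintype.card A) / η + 9 * η * H ^ 4 * K with hD
  have hdiff : ∑ k, ((value M (π k) (ℓ k) - value M π' (ℓ k)) -
      (value M (π k) (b k) - value M π' (b k))) ≤ H * D + ∑ k, value M π' (b k) := by
    simp only [value_sub_value M _ π' _ hH, ← episodeMean_sub, ← Finset.sum_sub_distrib]
    rw [← episodeMean_sum M π' Finset.univ]
    simp only [value_eq_episodeMean]
    rw [← episodeMean_sum M π' Finset.univ, ← episodeMean_const M π' (H * D), ← episodeMean_add]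
    refine episodeMean_mono M π' fun τ => ?_
    simp only [totalCost]
    rw [Finset.sum_comm, Finset.sum_comm (γ := Fin K)]
    calc _ ≤ ∑ h : Fin H, (D + ∑ k, b k h (τ h).1 (τ h).2) := Finset.sum_le_sum fun h _ =>
          sum_advantage_le M η γ ℓ hη hH hγ hηH hℓ ω π hπ hω h (τ h).1 (τ h).2
      _ = _ := by simp [Finset.sum_add_distrib]
  have hbonus : ∑ k, value M (π k) (b k) ≤
      K * (3 * γ * H ^ 2 * (Fintype.card S * Fintype.card A)) := by
    calc _ ≤ ∑ _k : Fin K, 3 * γ * H ^ 2 * (Fintype.card S * Fintype.card A : ℝ) :=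
          Finset.sum_le_sum fun k _ => value_bonusLoss_le M γ (π k) hγ0
      _ = _ := by simp
  simp only [Finset.sum_sub_distrib] at hdiff
  linarith

theorem regret_le (ω : Fin K → Traj S A H) {r : ℝ}
    (hr : ∀ π', ∑ k, value M (runPolicy M η γ ℓ ω k) (ℓ k) - ∑ k, value M π' (ℓ k) ≤ r) :
    regret M η γ ℓ ω ≤ r := by
  have : Nonempty (Policy S A H) := ⟨uniformPolicy S A H⟩
  rw [regret, sub_le_comm]
  exact le_ciInf fun π' => sub_le_comm.mp (hr π')

theorem regret_le_mul (hℓ : ∀ k h s a, ℓ k h s a ∈ Set.Icc (0 : ℝ) 1) (ω : Fin K → Traj S A H) :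
    regret M η γ ℓ ω ≤ K * H := by
  refine regret_le M η γ ℓ ω fun π' => ?_
  rw [← Finset.sum_sub_distrib]
  calc _ ≤ ∑ _k : Fin K, (H : ℝ) := Finset.sum_le_sum fun k _ => by
        have h1 := (value_mem_Icc M (runPolicy M η γ ℓ ω k) (hℓ k)).2
        have h2 := (value_mem_Icc M π' (hℓ k)).1
        linarith
    _ = _ := by simp

/-- With a single action there is a single policy. -/
theorem regret_le_zero_of_card_eq_one (hA : Fintype.card A = 1) (ω : Fin K → Traj S A H) :
    regret M η γ ℓ ω ≤ 0 := by
  obtain ⟨a₀, ha₀⟩ := Fintype.card_eq_one_iff.mp hA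
  have hone : ∀ π : Policy S A H, π.prob = fun _ _ _ => 1 := fun π => by
    funext h s a
    have hs := π.prob_sum h s
    rwa [Fintype.sum_eq_single a fun x hx => absurd ((ha₀ x).trans (ha₀ a).symm) hx] at hs
  refine regret_le M η γ ℓ ω fun π' => ?_
  have : ∀ k, runPolicy M η γ ℓ ω k = π' := fun k => by
    have h1 := (hone (runPolicy M η γ ℓ ω k)).trans (hone π').symm
    generalize runPolicy M η γ ℓ ω k = π at h1
    cases π; cases π'; cases h1; rfl
  simp [this]

end Runs

/-! ### The tuned parameters -/

section Tuning

/-- The right side of `sum_value_sub_value_le` at the tuned parameters; `x` stands for the number of state-action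
pairs. -/
theorem tuned_bound_le {η γ x h k Λ l L : ℝ} (hx : 0 ≤ x) (hh : 0 < h) (hk : 0 < k)
    (hη : η = (h * √(x * k) + h ^ 2 * √k)⁻¹) (hγ : γ = 2 * η * h) (hΛ : Λ ≤ L) (hl : l ≤ L)
    (hL : 1 ≤ L) :
    h * (Λ / η + l / η + 9 * η * h ^ 4 * k) + k * (3 * γ * h ^ 2 * x) ≤
      17 * L * (h ^ 2 * √(x * k) + h ^ 3 * √k) := by
  have hsk : 0 < √k := Real.sqrt_pos.mpr hk
  have hsx : 0 ≤ √(x * k) := Real.sqrt_nonneg _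
  have hkk : √k * √k = k := Real.mul_self_sqrt hk.le
  have hxk : √(x * k) * √(x * k) = x * k := Real.mul_self_sqrt (mul_nonneg hx hk.le)
  set p := √k
  set q := √(x * k)
  have hden : 0 < h * q + h ^ 2 * p := by positivity
  have hη0 : 0 < η := by rw [hη]; positivity
  have hone : η * (h * q + h ^ 2 * p) = 1 := by rw [hη]; exact inv_mul_cancel₀ hden.ne'
  have hq1 : η * (h * q) ≤ 1 := by
    have : 0 ≤ η * (h ^ 2 * p) := by positivity
    linarith
  have hp1 : η * (h ^ 2 * p) ≤ 1 := by
    have : 0 ≤ η * (h * q) := by positivity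
    linarith
  have hdiv : ∀ y, y / η = y * (h * q + h ^ 2 * p) := fun y => by
    rw [hη, div_inv_eq_mul]
  have h1 : h * (9 * η * h ^ 4 * k) ≤ 9 * (h ^ 3 * p) := by
    calc _ = 9 * (h ^ 3 * p) * (η * (h ^ 2 * p)) := by rw [← hkk]; ring
      _ ≤ 9 * (h ^ 3 * p) * 1 := mul_le_mul_of_nonneg_left hp1 (by positivity)
      _ = _ := mul_one _
  have h2 : k * (3 * γ * h ^ 2 * x) ≤ 6 * (h ^ 2 * q) := by
    calc _ = 6 * η * h ^ 3 * (x * k) := by rw [hγ]; ring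
      _ = 6 * (h ^ 2 * q) * (η * (h * q)) := by rw [← hxk]; ring
      _ ≤ 6 * (h ^ 2 * q) * 1 := mul_le_mul_of_nonneg_left hq1 (by positivity)
      _ = _ := mul_one _
  set T := h ^ 2 * q + h ^ 3 * p with hT
  have hT0 : 0 ≤ T := by positivity
  have hqT : h ^ 2 * q ≤ T := le_add_of_nonneg_right (by positivity)
  have hpT : h ^ 3 * p ≤ T := le_add_of_nonneg_left (by positivity)
  have hsplit : h * (Λ / η + l / η + 9 * η * h ^ 4 * k) =
      (Λ + l) * T + h * (9 * η * h ^ 4 * k) := by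
    rw [hdiv, hdiv]; ring
  have hTL := le_mul_of_one_le_left hT0 hL
  have hΛT := mul_le_mul_of_nonneg_right hΛ hT0
  have hlT := mul_le_mul_of_nonneg_right hl hT0
  rw [hsplit]
  linarith

variable {S A : Type*} {H : ℕ} [Fintype S] [Fintype A] [DecidableEq S] [DecidableEq A]
  [Nonempty A] {K : ℕ} (M : MDP S A H) (ℓ : Fin K → Cost S A H)

/-- A confidence statement for the regret once there are at least nine episodes, so that the
bonuses are at most one at the scale of the learning rate. -/
theorem one_sub_le_sum_runProb_regret (hH : 0 < H) (hK : 9 ≤ K)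
    (hℓ : ∀ k h s a, ℓ k h s a ∈ Set.Icc (0 : ℝ) 1) {η γ : ℝ}
    (hη : η = learningRate (Fintype.card S) (Fintype.card A) H K) (hγ : γ = 2 * η * H)
    {δ : ℝ} (hδ : 0 < δ) (hδ1 : δ < 1) (p : (Fin K → Traj S A H) → Prop) [DecidablePred p]
    (hp : ∀ ω, regret M η γ ℓ ω ≤
      17 * Real.log ((H : ℝ) * Fintype.card S * Fintype.card A * K / δ) *
        ((H : ℝ) ^ 2 * √((Fintype.card S : ℝ) * Fintype.card A * K) + (H : ℝ) ^ 3 * √(K : ℝ)) →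
      p ω) :
    1 - δ ≤ ∑ ω, if p ω then runProb M η γ ℓ ω else 0 := by
  have : Nonempty S := ⟨M.init⟩
  have : Nonempty ((Fin H × S) ⊕ (Fin H × S × A)) := ⟨Sum.inl (⟨0, hH⟩, M.init)⟩
  have hS1 : (1 : ℝ) ≤ Fintype.card S := by exact_mod_cast Fintype.card_pos
  have hA1 : (1 : ℝ) ≤ Fintype.card A := by exact_mod_cast Fintype.card_pos
  have hH1 : (1 : ℝ) ≤ H := by exact_mod_cast hH
  have hK9 : (9 : ℝ) ≤ K := by exact_mod_cast hK
  have hsK : 3 ≤ √(K : ℝ) := Real.le_sqrt_of_sq_le (by linarith)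
  unfold learningRate at hη
  have hη0 : 0 < η := by rw [hη]; positivity
  have hγ0 : 0 < γ := by rw [hγ]; positivity
  have hηH : η * (3 * (H : ℝ) ^ 2) ≤ 1 := by
    rw [hη, inv_mul_le_one₀ (by positivity)]
    have : 0 ≤ (H : ℝ) * √((Fintype.card S : ℝ) * Fintype.card A * K) := by positivity
    nlinarith [sq_nonneg (H : ℝ)]
  have hHS : (1 : ℝ) ≤ H * Fintype.card S := one_le_mul_of_one_le_of_one_le hH1 hS1
  have hHSA : (1 : ℝ) ≤ H * Fintype.card S * Fintype.card A :=
    one_le_mul_of_one_le_of_one_le hHS hA1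
  have hcard : (Fintype.card ((Fin H × S) ⊕ (Fin H × S × A)) : ℝ) ≤
      H * Fintype.card S * Fintype.card A * K := by
    simp only [Fintype.card_sum, Fintype.card_prod, Fintype.card_fin, Nat.cast_add, Nat.cast_mul]
    nlinarith
  have hX : (9 : ℝ) ≤ H * Fintype.card S * Fintype.card A * K := by nlinarith
  have hXδ : (H : ℝ) * Fintype.card S * Fintype.card A * K ≤
      H * Fintype.card S * Fintype.card A * K / δ :=
    le_div_self (by linarith) hδ hδ1.le
  refine one_sub_le_sum_runProb M η γ ℓ (deviation M η γ ℓ) ?_ hδ p fun ω hω => hp ω ?_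
  · rintro (⟨h, s⟩ | ⟨h, s, a⟩) k π
    · exact episodeMean_exp_average_le_one M γ π (ℓ k) hη0 hH hγ (hℓ k) h s
    · exact episodeMean_exp_uHat_sub_le_one M γ π (ℓ k) hH hγ0 (hℓ k) h s a
  · refine regret_le M η γ ℓ ω fun π' => ?_
    refine (sum_value_sub_value_le M η γ ℓ hη0 hH hγ hηH hℓ ω _ (fun _ => rfl) hω π').trans ?_
    refine tuned_bound_le (by positivity) (by positivity) (by positivity) hη hγ ?_ ?_ ?_
    · refine Real.log_le_log (div_pos (by exact_mod_cast Fintype.card_pos) hδ) ?_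
      exact div_le_div_of_nonneg_right hcard hδ.le
    · refine Real.log_le_log (by linarith) (le_trans ?_ hXδ)
      nlinarith
    · rw [Real.le_log_iff_exp_le (by linarith)]
      linarith [Real.exp_one_lt_d9]

end Tuning

end AggregateBandit

end

theorem theorem1 :
    ∃ C : ℝ, 0 < C ∧
      ∀ (S A : Type*) [Fintype S] [Fintype A] [DecidableEq S] [DecidableEq A] [Nonempty A]
        (H K : ℕ) (_ : 1 ≤ H) (_ : 1 ≤ K)
        (M : AggregateBandit.MDP S A H)
        (ℓ : Fin K → AggregateBandit.Cost S A H)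
        (_ : ∀ k h s a, ℓ k h s a ∈ Set.Icc (0 : ℝ) 1)
        (η γ : ℝ)
        (_ : η = AggregateBandit.learningRate (Fintype.card S) (Fintype.card A) H K)
        (_ : γ = 2 * η * H)
        (δ : ℝ) (_ : 0 < δ) (_ : δ < 1),
        ENNReal.ofReal (1 - δ) ≤
          AggregateBandit.runMeasure M η γ ℓ
            {ω | AggregateBandit.regret M η γ ℓ ω ≤
              C * Real.log ((H : ℝ) * Fintype.card S * Fintype.card A * K / δ) *
                ((H : ℝ) ^ 2 * √((Fintype.card S : ℝ) * Fintype.card A * K)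
                  + (H : ℝ) ^ 3 * √(K : ℝ))} := by
  refine ⟨17, by norm_num, ?_⟩
  intro S A _ _ _ _ _ H K hH hK M ℓ hℓ η γ hη hγ δ hδ hδ1
  classical
  have : Nonempty S := ⟨M.init⟩
  rw [AggregateBandit.runMeasure_apply]
  refine ENNReal.ofReal_le_ofReal ?_
  by_cases hK9 : 9 ≤ K
  · exact AggregateBandit.one_sub_le_sum_runProb_regret M ℓ hH hK9 hℓ hη hγ hδ hδ1 _
      fun ω hω => hω
  -- With fewer than nine episodes the trivial bound `K * H` on the regret suffices.
  · have hS1 : (1 : ℝ) ≤ Fintype.card S := by exact_mod_cast Fintype.card_pos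
    have hA1 : (1 : ℝ) ≤ Fintype.card A := by exact_mod_cast Fintype.card_pos
    have hH1 : (1 : ℝ) ≤ H := by exact_mod_cast hH
    have hK1 : (1 : ℝ) ≤ K := by exact_mod_cast hK
    have hK9' : (K : ℝ) ≤ 9 := by exact_mod_cast (not_le.mp hK9).le
    have hHS : (1 : ℝ) ≤ H * Fintype.card S := one_le_mul_of_one_le_of_one_le hH1 hS1
    have hHSA : (Fintype.card A : ℝ) ≤ H * Fintype.card S * Fintype.card A := by nlinarith
    have hX : (Fintype.card A : ℝ) ≤ H * Fintype.card S * Fintype.card A * K := by nlinarith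
    have hXδ : (H : ℝ) * Fintype.card S * Fintype.card A * K ≤
        H * Fintype.card S * Fintype.card A * K / δ :=
      le_div_self (by linarith) hδ hδ1.le
    have hT : (H : ℝ) ≤ (H : ℝ) ^ 2 * √((Fintype.card S : ℝ) * Fintype.card A * K) +
        (H : ℝ) ^ 3 * √(K : ℝ) := by
      have h1 : 1 ≤ √(K : ℝ) := Real.one_le_sqrt.mpr hK1
      have h2 : (H : ℝ) ≤ (H : ℝ) ^ 3 := le_self_pow₀ hH1 (by norm_num)
      have h3 : 0 ≤ (H : ℝ) ^ 2 * √((Fintype.card S : ℝ) * Fintype.card A * K) := by positivity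
      nlinarith
    have hall : ∀ ω, AggregateBandit.regret M η γ ℓ ω ≤
        17 * Real.log ((H : ℝ) * Fintype.card S * Fintype.card A * K / δ) *
          ((H : ℝ) ^ 2 * √((Fintype.card S : ℝ) * Fintype.card A * K)
            + (H : ℝ) ^ 3 * √(K : ℝ)) := by
      intro ω
      rcases (Nat.one_le_iff_ne_zero.mpr Fintype.card_ne_zero :
        1 ≤ Fintype.card A).eq_or_lt with hA | hA
      · refine (AggregateBandit.regret_le_zero_of_card_eq_one M η γ ℓ hA.symm ω).trans ?_
        have hlog : 0 ≤ Real.log ((H : ℝ) * Fintype.card S * Fintype.card A * K / δ) :=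
          Real.log_nonneg (by linarith)
        positivity
      · refine (AggregateBandit.regret_le_mul M η γ ℓ hℓ ω).trans ?_
        have hA2 : (2 : ℝ) ≤ Fintype.card A := by exact_mod_cast hA
        have hlog : Real.log 2 ≤ Real.log ((H : ℝ) * Fintype.card S * Fintype.card A * K / δ) :=
          Real.log_le_log (by norm_num) (by linarith)
        have h9 : 9 ≤ 17 * Real.log ((H : ℝ) * Fintype.card S * Fintype.card A * K / δ) := by
          linarith [Real.log_two_gt_d9]
        exact mul_le_mul (hK9'.trans h9) hT (by linarith) (by linarith)
    have hsum : ∀ ω, (if ω ∈ {ω | AggregateBandit.regret M η γ ℓ ω ≤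
        17 * Real.log ((H : ℝ) * Fintype.card S * Fintype.card A * K / δ) *
          ((H : ℝ) ^ 2 * √((Fintype.card S : ℝ) * Fintype.card A * K)
            + (H : ℝ) ^ 3 * √(K : ℝ))} then AggregateBandit.runProb M η γ ℓ ω else 0) =
        AggregateBandit.runProb M η γ ℓ ω := fun ω => if_pos (hall ω)
    rw [Finset.sum_congr rfl fun ω _ => hsum ω, AggregateBandit.sum_runProb]
    linarith
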